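/- Let $r\ge 0$, $s\ge 1$, $N$ be integers, and let $\mu_1,\dots,\mu_s,\nu_1,\dots,\nu_r$ be non-negative integers; put $\nu_0:=0$. For parameters such that a vertical line separates the poles of the functions $\Gamma(b_j-u)$, $j\le m$ (on its right) from those of the functions $\Gamma(1-a_j+u)$, $j\le n$ (on its left), let $$G^{m,n}_{p,q}\Big(z\,\Big|\,{a_1,\dots,a_p\atop b_1,\dots,b_q}\Big)=\frac1{2\pi i}\int_{c-i\infty}^{c+i\infty}\frac{\prod_{j=1}^m\Gamma(b_j-u)\prod_{j=1}^n\Gamma(1-a_j+u)}{\prod_{j=m+1}^q\Gamma(1-b_j+u)\prod_{j=n+1}^p\Gamma(a_j-u)}\,z^u\,du$$ denote the Meijer $G$-function, where $\operatorname{Re}u=c$ is any such line. For $j=1,\dots,N$ and $x>0$ put $$I_j(x)=G^{r,s}_{s,r}\Big(x\,\Big|\,{-(\mu_1+j-1+N),-(\mu_2+N),\dots,-(\mu_s+N)\atop \nu_1,\dots,\nu_r}\Big),$$ and consider the density on $(0,\infty)^N$ proportional to $$\prod_{1\le j<k\le N}(x_k-x_j)\;\det\big[I_j(x_k)\big]_{j,k=1,\dots,N}.$$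 For $0\le l,n\le N-1$ define $$C_l=(-1)^l\prod_{j=0}^r\Gamma(\nu_j+l+1)\prod_{p=1}^s\Gamma(\mu_p+N-l),\qquad Q_l(x)=\frac{(-1)^l}{C_l}\,G^{r+1,s}_{s+1,r+1}\Big(x\,\Big|\,{-(\mu_1+N),\dots,-(\mu_s+N),-l\atop \nu_0,\nu_1,\dots,\nu_r}\Big),$$ $$P_n(x)=(-1)^n\prod_{j=1}^r\frac{\Gamma(\nu_j+n+1)}{\Gamma(\nu_j+1)}\prod_{l=1}^s\frac{\Gamma(\mu_l+N-n)}{\Gamma(\mu_l+N)}\;{}_{s+1}F_r\Big({-n,1-\mu_1-N,\dots,1-\mu_s-N\atop 1+\nu_1,\dots,1+\nu_r}\,\Big|\,(-1)^s x\Big).$$ Then all these contour integrals converge absolutely, and $(P_n),(Q_l)$ is the unique biorthogonal system of the ensemble: $P_n$ is a monic polynomial of degree $n$, $Q_l$ is on $(0,\infty)$ a linear combination of $I_1,\dots,I_{l+1}$, and $$\int_0^\infty P_n(x)Q_l(x)\,dx=\delta_{n,l}\qquad(0\le n,l\le N-1).$$ Moreover the weight above is integrable on $(0,\infty)^N$ with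 non-zero integral, and with $K_N(x,y)=\sum_{l=0}^{N-1}P_l(x)Q_l(y)$ the $k$-point correlation functions of the normalized density (that is, $\frac{N!}{(N-k)!}$ times the integral of the density over the last $N-k$ variables) are $\rho_{(k)}(x_1,\dots,x_k)=\det[K_N(x_i,x_j)]_{i,j=1,\dots,k}$ for $0\le k\le N$ and $x_1,\dots,x_k>0$. -/

import Mathlib

open scoped BigOperators

/-- The quotient of Gamma functions in the integrand of the Meijer function `G^{m,n}_{p,q}`
with upper parameters `a_1, …, a_p` and lower parameters `b_1, …, b_q` (indexed from `0` here).
At a pole of a Gamma function in the denominator, Mathlib's value `Gamma = 0`, `1 / 0 = 0`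
agrees with the value `0` of the entire function `1 / Gamma`. -/
noncomputable def meijerKernel (m n : ℕ) {p q : ℕ} (a : Fin p → ℂ) (b : Fin q → ℂ) (u : ℂ) : ℂ :=
  ((∏ j : Fin q with j.val < m, Complex.Gamma (b j - u)) *
      (∏ j : Fin p with j.val < n, Complex.Gamma (1 - a j + u))) /
    ((∏ j : Fin q with m ≤ j.val, Complex.Gamma (1 - b j + u)) *
      (∏ j : Fin p with n ≤ j.val, Complex.Gamma (a j - u)))

/-- The vertical line `Re u = c` separates the poles of `Γ(b_j - u)`, `j ≤ m` (on its right) from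
the poles of `Γ(1 - a_j + u)`, `j ≤ n` (on its left). -/
def SeparatesPoles (c : ℝ) (m n : ℕ) {p q : ℕ} (a : Fin p → ℂ) (b : Fin q → ℂ) : Prop :=
  (∀ j : Fin q, j.val < m → c < (b j).re) ∧ (∀ j : Fin p, j.val < n → (a j).re - 1 < c)

/-- The Meijer function `G^{m,n}_{p,q}(z | a; b)`, with contour the upwards oriented vertical line
`Re u = c`: `(1 / 2πi) ∫_{c - i∞}^{c + i∞} (…) z^u du`. -/
noncomputable def meijerG (c : ℝ) (m n : ℕ) {p q : ℕ} (a : Fin p → ℂ) (b : Fin q → ℂ) (z : ℂ) : ℂ :=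
  (1 / (2 * (Real.pi : ℂ) * Complex.I)) *
    ∫ t : ℝ, meijerKernel m n a b (c + t * Complex.I) * z ^ ((c : ℂ) + t * Complex.I) * Complex.I

/-- The generalized hypergeometric series `{}_pF_q(a; b | x)`, with
`(c)_k = c (c+1) ⋯ (c+k-1)`. -/
noncomputable def hypergeomPFQ {p q : ℕ} (a : Fin p → ℂ) (b : Fin q → ℂ) (x : ℂ) : ℂ :=
  ∑' k : ℕ, ((∏ i, (ascPochhammer ℂ k).eval (a i)) / (∏ i, (ascPochhammer ℂ k).eval (b i))) *
    (x ^ k / (k.factorial : ℂ))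

/-! ### Ensembles `∏_{j<k} (x_k - x_j) det [φ_j(x_k)]` on `(0,∞)^N` -/

/-- The open positive orthant. -/
def posOrthant (n : ℕ) : Set (Fin n → ℝ) := {y | ∀ i, 0 < y i}

/-- The weight `∏_{j<k} (x_k - x_j) · det [φ_j(x_k)]_{j,k}`. -/
noncomputable def ensembleWeight {N : ℕ} (φ : Fin N → ℝ → ℂ) (x : Fin N → ℝ) : ℂ :=
  (∏ j : Fin N, ∏ k ∈ Finset.Ioi j, ((x k : ℂ) - (x j : ℂ))) *
    (Matrix.of fun j k : Fin N => φ j (x k)).det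

/-- The point of `ℝ^N` whose first `k` coordinates are `x` and whose other ones are `y`. -/
def joinCoords {N k : ℕ} (x : Fin k → ℝ) (y : Fin (N - k) → ℝ) : Fin N → ℝ := fun i =>
  if h : i.val < k then x ⟨i.val, h⟩ else y ⟨i.val - k, by have := i.isLt; omega⟩

/-- The `k`-point correlation function
`ρ_k(x_1, …, x_k) = N! / (N-k)! ∫_{(0,∞)^{N-k}} p(x_1, …, x_N) dx_{k+1} ⋯ dx_N`
of the normalized density `p = w / ∫ w` on `(0,∞)^N`. -/
noncomputable def correlationFunction {N : ℕ} (w : (Fin N → ℝ) → ℂ) (k : ℕ) (x : Fin k → ℝ) : ℂ :=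
  ((N.factorial : ℂ) / ((N - k).factorial : ℂ)) *
    ∫ y in posOrthant (N - k), w (joinCoords x y) / ∫ z in posOrthant N, w z

/-- `(P_n), (Q_l)`, `0 ≤ n, l ≤ N-1`, is a biorthogonal system on `(0,∞)` for the ensemble with
functions `φ_0, …, φ_{N-1}`: `P_n` is a monic polynomial of degree `n`, `Q_l` is in the linear
span of `φ_0, …, φ_l`, and `∫_0^∞ P_n Q_l dx = δ_{n,l}` (with convergent integral). -/
structure IsBiorthogonalSystem {N : ℕ} (φ : Fin N → ℝ → ℂ) (P Q : Fin N → ℝ → ℂ) : Prop where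
  monic : ∀ n : Fin N, ∃ p : Polynomial ℂ, p.Monic ∧ p.natDegree = n.val ∧
    ∀ x : ℝ, P n x = p.eval (x : ℂ)
  span : ∀ l : Fin N, ∃ d : Fin N → ℂ, ∀ x : ℝ, 0 < x →
    Q l x = ∑ j ∈ Finset.Iic l, d j * φ j x
  integrable : ∀ n l : Fin N,
    MeasureTheory.IntegrableOn (fun x : ℝ => P n x * Q l x) (Set.Ioi 0)
  biorthogonal : ∀ n l : Fin N,
    ∫ x in Set.Ioi (0 : ℝ), P n x * Q l x = if n = l then 1 else 0

/-- The kernel `K_N(x, y) = ∑_{l=0}^{N-1} P_l(x) Q_l(y)`. -/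
noncomputable def biorthogonalKernel {N : ℕ} (P Q : Fin N → ℝ → ℂ) (x y : ℝ) : ℂ :=
  ∑ l : Fin N, P l x * Q l y

/-! ### The objects attached to the product of `r` Gaussian and `s` inverse Gaussian matrices

The lists `μ_1, …, μ_s` and `ν_1, …, ν_r` are indexed from `0`; row `j` of the determinant and
the index `j : Fin N` here are related by `row = j + 1`. -/

/-- Upper parameters `-(μ_1 + j + N), -(μ_2 + N), …, -(μ_s + N)` of the functions in the
determinant; `j = 0, …, N-1`. -/
def weightUpper (N : ℕ) {s : ℕ} (μ : Fin s → ℕ) (j : ℕ) : Fin s → ℂ := fun i =>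
  if i.val = 0 then -((μ i : ℂ) + j + N) else -((μ i : ℂ) + N)

/-- Lower parameters `ν_1, …, ν_r`. -/
def weightLower {r : ℕ} (ν : Fin r → ℕ) : Fin r → ℂ := fun i => (ν i : ℂ)

/-- Upper parameters `-(μ_1 + N), …, -(μ_s + N), -l`. -/
def dualUpper (N : ℕ) {s : ℕ} (μ : Fin s → ℕ) (l : ℕ) : Fin (s + 1) → ℂ :=
  Fin.snoc (α := fun _ => ℂ) (fun i : Fin s => -((μ i : ℂ) + N)) (-(l : ℂ))

/-- The list `ν_0, ν_1, …, ν_r` with `ν_0 = 0`. -/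
def extendedNu {r : ℕ} (ν : Fin r → ℕ) : Fin (r + 1) → ℕ :=
  Fin.cons (α := fun _ => ℕ) 0 ν

/-- Lower parameters `ν_0, ν_1, …, ν_r`. -/
def dualLower {r : ℕ} (ν : Fin r → ℕ) : Fin (r + 1) → ℂ := fun i => (extendedNu ν i : ℂ)

/-- Entry function `G^{r,s}_{s,r}(x | -(μ_1+j+N), -(μ_2+N), …, -(μ_s+N); ν_1, …, ν_r)` of the
determinant, with contour `Re u = c`. -/
noncomputable def weightFun (N : ℕ) {r s : ℕ} (μ : Fin s → ℕ) (ν : Fin r → ℕ) (c : ℝ) (j : ℕ)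
    (x : ℝ) : ℂ :=
  meijerG c r s (weightUpper N μ j) (weightLower ν) (x : ℂ)

/-- `C_l = (-1)^l ∏_{j=0}^r Γ(ν_j + l + 1) ∏_{p=1}^s Γ(μ_p + N - l)`. -/
noncomputable def constC (N : ℕ) {r s : ℕ} (μ : Fin s → ℕ) (ν : Fin r → ℕ) (l : ℕ) : ℂ :=
  (-1) ^ l * (∏ j : Fin (r + 1), Complex.Gamma ((extendedNu ν j : ℂ) + l + 1)) *
    ∏ i : Fin s, Complex.Gamma ((μ i : ℂ) + N - l)

/-- `Q_l(x) = ((-1)^l / C_l) G^{r+1,s}_{s+1,r+1}(x | -(μ_1+N), …, -(μ_s+N), -l; ν_0, …, ν_r)`,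
with contour `Re u = c`. -/
noncomputable def dualFun (N : ℕ) {r s : ℕ} (μ : Fin s → ℕ) (ν : Fin r → ℕ) (c : ℝ) (l : ℕ)
    (x : ℝ) : ℂ :=
  ((-1) ^ l / constC N μ ν l) * meijerG c (r + 1) s (dualUpper N μ l) (dualLower ν) (x : ℂ)

/-- `P_n(x) = (-1)^n ∏_j Γ(ν_j+n+1)/Γ(ν_j+1) ∏_l Γ(μ_l+N-n)/Γ(μ_l+N) ·
{}_{s+1}F_r(-n, 1-μ_1-N, …, 1-μ_s-N; 1+ν_1, …, 1+ν_r | (-1)^s x)`. -/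
noncomputable def polyFun (N : ℕ) {r s : ℕ} (μ : Fin s → ℕ) (ν : Fin r → ℕ) (n : ℕ)
    (x : ℝ) : ℂ :=
  (-1) ^ n *
    (∏ j : Fin r, Complex.Gamma ((ν j : ℂ) + n + 1) / Complex.Gamma ((ν j : ℂ) + 1)) *
    (∏ i : Fin s, Complex.Gamma ((μ i : ℂ) + N - n) / Complex.Gamma ((μ i : ℂ) + N)) *
    hypergeomPFQ (Fin.cons (α := fun _ => ℂ) (-(n : ℂ)) (fun i : Fin s => 1 - (μ i : ℂ) - N))
      (fun j : Fin r => 1 + (ν j : ℂ)) ((-1) ^ s * (x : ℂ))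

/-!
A Meijer function whose Gamma factors all stand in numerators is the inverse Mellin transform of a
Gamma product that decays on vertical lines, so its moments are the values of that product at the
positive integers. For the functions `Q_l` the product carries the extra factor
`(u - 1) ⋯ (u - l)`, with `u` the Mellin variable. Hence the `k`-th moment of `Q_l` is
`C(k, l) m_k / m_l`, and biorthogonality to the hypergeometric polynomials, with coefficients
`(-1) ^ (n + k) C(n, k) m_n / m_k`, is binomial inversion. Expanding the polynomial factor in rising
factorials of the parameter that varies in the weight shows that `Q_l` lies in the span of the first
`l + 1` weight functions. The rest is linear algebra: uniqueness is uniqueness of the LU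
factorization of the inverse moment matrix, and the correlation functions follow by Andréief
integration from the two determinants in the weight.
-/

section MellinInversion

open Complex Set MeasureTheory
open scoped FourierTransform

variable {E : Type*} [NormedAddCommGroup E] {f : ℝ → E} {F : ℂ → E} {σ : ℝ}

theorem integrable_comp_two_pi_mul (hF : VerticalIntegrable F σ) :
    Integrable fun y : ℝ => F (σ + 2 * Real.pi * y * I) := by
  simpa using Integrable.comp_mul_left' hF (g := fun y => F (σ + y * I))
    (R := 2 * Real.pi) (by simp [Real.pi_ne_zero])

variable [NormedSpace ℂ E]

theorem mellinConvergent_natCast_add_one_iff {k : ℕ} :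
    MellinConvergent f (k + 1) ↔ IntegrableOn (fun x : ℝ => (x : ℂ) ^ k • f x) (Ioi 0) := by
  simp [MellinConvergent]

theorem mellin_natCast_add_one (f : ℝ → E) (k : ℕ) :
    mellin f (k + 1) = ∫ x in Ioi (0 : ℝ), (x : ℂ) ^ k • f x := by
  simp [mellin]

theorem mellinConvergent_ofReal_iff_integrable_exp :
    MellinConvergent f σ ↔ Integrable fun u : ℝ => Real.exp (-σ * u) • f (Real.exp (-u)) := by
  have himage : (fun u : ℝ => Real.exp (-u)) '' univ = Ioi 0 := by
    rw [image_univ]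
    exact (neg_surjective.range_comp Real.exp).trans Real.range_exp
  have hderiv : ∀ u ∈ univ, HasDerivWithinAt (fun u : ℝ => Real.exp (-u)) (-Real.exp (-u)) univ u :=
    fun u _ => by simpa using (hasDerivAt_neg u).exp
  rw [MellinConvergent, ← himage, integrableOn_image_iff_integrableOn_abs_deriv_smul
    MeasurableSet.univ hderiv (Real.exp_injective.comp neg_injective).injOn, integrableOn_univ]
  refine integrable_congr (ae_of_all _ fun u => ?_)
  have hexp : (Real.exp (-u) : ℂ) ^ ((σ : ℂ) - 1) = (Real.exp (-u * (σ - 1)) : ℝ) := by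
    rw [← ofReal_one, ← ofReal_sub, ← ofReal_cpow (Real.exp_pos _).le, ← Real.exp_mul]
  simp only [hexp, abs_neg, Real.abs_exp, Complex.coe_smul, smul_smul, ← Real.exp_add]
  ring_nf

theorem exp_smul_mellinInv_exp_neg (σ : ℝ) (F : ℂ → E) (u : ℝ) :
    Real.exp (-σ * u) • mellinInv σ F (Real.exp (-u)) =
      𝓕⁻ (fun y : ℝ => F (σ + 2 * Real.pi * y * I)) u := by
  have hcancel : (Real.exp (-σ * u) : ℂ) * (Real.exp (-u) : ℂ) ^ (-σ : ℂ) = 1 := by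
    rw [← ofReal_neg, ← ofReal_cpow (Real.exp_pos _).le, ← Real.exp_mul, ← ofReal_mul,
      ← Real.exp_add]
    simp [mul_comm]
  rw [mellinInv_eq_fourierInv _ _ (Real.exp_pos _), Real.log_exp, neg_neg, ← Complex.coe_smul,
    smul_smul, hcancel, one_smul]

theorem mellin_mellinInv_eq [CompleteSpace E] {s : ℂ} (hF : VerticalIntegrable F s.re)
    (hcont : Continuous fun t : ℝ => F (s.re + t * I))
    (hconv : MellinConvergent (mellinInv s.re F) s.re) : mellin (mellinInv s.re F) s = F s := by
  set G : ℝ → E := fun y => F (s.re + 2 * Real.pi * y * I) with hG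
  have hGint : Integrable G := integrable_comp_two_pi_mul hF
  have hGcont : Continuous G := by
    simpa [hG, Function.comp_def] using hcont.comp (continuous_const_mul (2 * Real.pi))
  have hGhat : Integrable (𝓕⁻ G) := by
    simpa only [exp_smul_mellinInv_exp_neg] using!
      mellinConvergent_ofReal_iff_integrable_exp.1 hconv
  have hGhat' : Integrable (𝓕 G) :=
    hGhat.comp_neg.congr (ae_of_all _ fun u => by simp [Real.fourierInv_eq_fourier_neg])
  have hline : (s.re : ℂ) + 2 * Real.pi * (s.im / (2 * Real.pi) : ℝ) * I = s := by
    push_cast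
    rw [mul_div_cancel₀ _ (by simp [Real.pi_ne_zero]), re_add_im]
  simp only [mellin_eq_fourier, exp_smul_mellinInv_exp_neg]
  rw [hGcont.fourier_fourierInv_eq hGint hGhat']
  exact congrArg F hline

theorem mellinInv_congr {F G : ℂ → E} {σ : ℝ} (h : EqOn F G (re ⁻¹' {σ})) :
    mellinInv σ F = mellinInv σ G := by
  have hline : ∀ t : ℝ, F (σ + t * I) = G (σ + t * I) := fun t => h (by simp)
  ext x
  simp only [mellinInv, hline]

theorem mellinInv_const_smul (σ : ℝ) (c : ℂ) (F : ℂ → E) (x : ℝ) :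
    mellinInv σ (fun s => c • F s) x = c • mellinInv σ F x := by
  simp only [mellinInv, smul_comm _ c, integral_smul]

theorem norm_mellinInv_le (σ : ℝ) (F : ℂ → E) {x : ℝ} (hx : 0 < x) :
    ‖mellinInv σ F x‖ ≤ 1 / (2 * Real.pi) * (∫ t : ℝ, ‖F (σ + t * I)‖) * x ^ (-σ) := by
  rw [mellinInv, norm_smul, Real.norm_of_nonneg (by positivity), mul_assoc, ← integral_mul_const]
  gcongr
  refine (norm_integral_le_integral_norm _).trans_eq (integral_congr_ae (ae_of_all _ fun t => ?_))
  simp only [norm_smul, norm_cpow_eq_rpow_re_of_pos hx]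
  simp [mul_comm]

theorem continuousOn_mellinInv (hF : VerticalIntegrable F σ) :
    ContinuousOn (mellinInv σ F) (Ioi 0) := by
  have hcont : Continuous (𝓕⁻ fun y : ℝ => F (σ + 2 * Real.pi * y * I)) :=
    VectorFourier.fourierIntegral_continuous Real.continuous_fourierChar (by fun_prop)
      (integrable_comp_two_pi_mul hF)
  refine ContinuousOn.congr (ContinuousOn.smul ?_ ?_) fun x hx => mellinInv_eq_fourierInv σ F hx
  · exact fun x hx =>
      (continuousAt_ofReal_cpow_const x _ (Or.inr (ne_of_gt hx))).continuousWithinAt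
  · exact hcont.comp_continuousOn
      (Real.continuousOn_log.mono fun x hx => ne_of_gt (mem_Ioi.1 hx)).neg

end MellinInversion

section StripDecay

open Complex Set MeasureTheory Filter Topology

variable {E : Type*} [NormedAddCommGroup E] [NormedSpace ℂ E]

/-- `F` is holomorphic on the vertical strip `re s ∈ S` and of order `1 / (1 + (im s)²)` there,
uniformly over compact ranges of `re s`. The set `S` is meant to be an interval. This is the class
of integrands for which vertical contours can be shifted and the Mellin transform inverted. -/
structure StripDecay (F : ℂ → E) (S : Set ℝ) : Prop where
  differentiableOn : DifferentiableOn ℂ F (re ⁻¹' S)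
  exists_bound : ∀ c₁ ∈ S, ∀ c₂ ∈ S, ∃ C : ℝ, ∀ s : ℂ, s.re ∈ Icc c₁ c₂ →
    ‖F s‖ ≤ C * (1 + s.im ^ 2)⁻¹

namespace StripDecay

section Operations

variable {F : ℂ → E} {S T : Set ℝ}

theorem mono (h : StripDecay F S) (hTS : T ⊆ S) : StripDecay F T :=
  ⟨h.differentiableOn.mono (preimage_mono hTS),
    fun c₁ h₁ c₂ h₂ => h.exists_bound c₁ (hTS h₁) c₂ (hTS h₂)⟩

theorem congr {G : ℂ → E} [S.OrdConnected] (h : StripDecay F S) (hFG : EqOn F G (re ⁻¹' S)) :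
    StripDecay G S := by
  refine ⟨h.differentiableOn.congr fun s hs => (hFG hs).symm, fun c₁ h₁ c₂ h₂ => ?_⟩
  obtain ⟨C, hC⟩ := h.exists_bound c₁ h₁ c₂ h₂
  exact ⟨C, fun s hs => hFG (OrdConnected.out ‹_› h₁ h₂ hs) ▸ hC s hs⟩

theorem smul {f : ℂ → ℂ} (h : StripDecay F S) (hf : DifferentiableOn ℂ f (re ⁻¹' S))
    (hbound : ∀ c₁ ∈ S, ∀ c₂ ∈ S, ∃ C : ℝ, ∀ s : ℂ, s.re ∈ Icc c₁ c₂ → ‖f s‖ ≤ C) :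
    StripDecay (fun s => f s • F s) S := by
  refine ⟨hf.fun_smul h.differentiableOn, fun c₁ h₁ c₂ h₂ => ?_⟩
  obtain ⟨B, hB⟩ := hbound c₁ h₁ c₂ h₂
  obtain ⟨C, hC⟩ := h.exists_bound c₁ h₁ c₂ h₂
  refine ⟨B * C, fun s hs => ?_⟩
  rw [norm_smul, mul_assoc]
  exact mul_le_mul (hB s hs) (hC s hs) (norm_nonneg _) ((norm_nonneg _).trans (hB s hs))

theorem const_smul (h : StripDecay F S) (c : ℂ) : StripDecay (fun s => c • F s) S :=
  h.smul (differentiableOn_const c) fun _ _ _ _ => ⟨‖c‖, fun _ _ => le_rfl⟩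

theorem sum {ι : Type*} {F : ι → ℂ → E} {t : Finset ι} (h : ∀ i ∈ t, StripDecay (F i) S) :
    StripDecay (fun s => ∑ i ∈ t, F i s) S := by
  refine ⟨DifferentiableOn.fun_sum fun i hi => (h i hi).differentiableOn, fun c₁ h₁ c₂ h₂ => ?_⟩
  choose! C hC using fun i hi => (h i hi).exists_bound c₁ h₁ c₂ h₂
  refine ⟨∑ i ∈ t, C i, fun s hs => ?_⟩
  rw [Finset.sum_mul]
  exact norm_sum_le_of_le t fun i hi => hC i hi s hs

theorem cpow_smul (h : StripDecay F S) {x : ℝ} (hx : 0 < x) :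
    StripDecay (fun s => (x : ℂ) ^ (-s) • F s) S := by
  refine h.smul (fun s _ => ?_) fun c₁ _ c₂ _ => ⟨x ^ (-c₁) + x ^ (-c₂), fun s hs => ?_⟩
  · exact (differentiableAt_id.neg.const_cpow
      (Or.inl (ofReal_ne_zero.2 hx.ne'))).differentiableWithinAt
  · rw [norm_cpow_eq_rpow_re_of_pos hx, neg_re]
    rcases le_total 1 x with h1 | h1
    · exact (Real.rpow_le_rpow_of_exponent_le h1 (neg_le_neg hs.1)).trans
        (le_add_of_nonneg_right (by positivity))
    · exact (Real.rpow_le_rpow_of_exponent_ge hx h1 (neg_le_neg hs.2)).trans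
        (le_add_of_nonneg_left (by positivity))

theorem mul {F G : ℂ → ℂ} (hF : StripDecay F S) (hG : StripDecay G S) :
    StripDecay (fun s => F s * G s) S := by
  refine hG.smul hF.differentiableOn fun c₁ h₁ c₂ h₂ => ?_
  obtain ⟨C, hC⟩ := hF.exists_bound c₁ h₁ c₂ h₂
  refine ⟨|C|, fun s hs => (hC s hs).trans ?_⟩
  have hle : (1 + s.im ^ 2)⁻¹ ≤ 1 := inv_le_one_of_one_le₀ (by nlinarith [sq_nonneg s.im])
  calc C * (1 + s.im ^ 2)⁻¹ ≤ |C| * (1 + s.im ^ 2)⁻¹ := by gcongr; exact le_abs_self C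
    _ ≤ |C| := mul_le_of_le_one_right (abs_nonneg C) hle

theorem prod {ι : Type*} {F : ι → ℂ → ℂ} {t : Finset ι} (ht : t.Nonempty)
    (h : ∀ i ∈ t, StripDecay (F i) S) : StripDecay (fun s => ∏ i ∈ t, F i s) S := by
  induction ht using Finset.Nonempty.cons_induction with
  | singleton i => simpa using h i (Finset.mem_singleton_self i)
  | cons i t hi ht ih =>
    simp only [Finset.prod_cons]
    exact (h i (Finset.mem_cons_self i t)).mul (ih fun j hj => h j (Finset.mem_cons_of_mem hj))

theorem comp_const_add (h : StripDecay F S) (a : ℂ) :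
    StripDecay (fun s => F (a + s)) {σ | a.re + σ ∈ S} := by
  refine ⟨h.differentiableOn.comp (by fun_prop) fun s hs => hs, fun c₁ h₁ c₂ h₂ => ?_⟩
  obtain ⟨C, hC⟩ := h.exists_bound _ h₁ _ h₂
  refine ⟨|C| * (2 * (1 + a.im ^ 2)), fun s hs => ?_⟩
  have hs' : (a + s).re ∈ Icc (a.re + c₁) (a.re + c₂) := by simpa using hs
  have hweight : (1 + (a + s).im ^ 2)⁻¹ ≤ 2 * (1 + a.im ^ 2) * (1 + s.im ^ 2)⁻¹ := by
    rw [inv_le_iff_one_le_mul₀ (by positivity), mul_right_comm, ← div_eq_mul_inv,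
      one_le_div (by positivity), add_im]
    nlinarith [sq_nonneg (2 * a.im + s.im), sq_nonneg (a.im * (a.im + s.im))]
  calc ‖F (a + s)‖ ≤ C * (1 + (a + s).im ^ 2)⁻¹ := hC _ hs'
    _ ≤ |C| * (1 + (a + s).im ^ 2)⁻¹ := by gcongr; exact le_abs_self C
    _ ≤ |C| * (2 * (1 + a.im ^ 2) * (1 + s.im ^ 2)⁻¹) := by gcongr
    _ = |C| * (2 * (1 + a.im ^ 2)) * (1 + s.im ^ 2)⁻¹ := by ring

theorem comp_neg (h : StripDecay F S) : StripDecay (fun s => F (-s)) {σ | -σ ∈ S} := by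
  refine ⟨h.differentiableOn.comp (by fun_prop) fun s hs => by simpa using hs,
    fun c₁ h₁ c₂ h₂ => ?_⟩
  obtain ⟨C, hC⟩ := h.exists_bound _ h₂ _ h₁
  exact ⟨C, fun s hs => by simpa using hC (-s) ⟨by simpa using hs.2, by simpa using hs.1⟩⟩

end Operations

section ContourShift

variable {F : ℂ → E} {S : Set ℝ} {σ σ₁ σ₂ : ℝ}

theorem continuous_vertical (h : StripDecay F S) (hσ : σ ∈ S) :
    Continuous fun t : ℝ => F (σ + t * I) :=
  h.differentiableOn.continuousOn.comp_continuous (by fun_prop) fun t => by simpa using hσ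

theorem verticalIntegrable (h : StripDecay F S) (hσ : σ ∈ S) : VerticalIntegrable F σ := by
  obtain ⟨C, hC⟩ := h.exists_bound σ hσ σ hσ
  refine (integrable_inv_one_add_sq.const_mul C).mono'
    (h.continuous_vertical hσ).aestronglyMeasurable (ae_of_all _ fun t => ?_)
  simpa using hC (σ + t * I) (by simp)

theorem mellinInv_sum {ι : Type*} {F : ι → ℂ → E} {t : Finset ι}
    (h : ∀ i ∈ t, StripDecay (F i) S) (hσ : σ ∈ S) {x : ℝ} (hx : 0 < x) :
    mellinInv σ (fun s => ∑ i ∈ t, F i s) x = ∑ i ∈ t, mellinInv σ (F i) x := by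
  simp only [mellinInv, Finset.smul_sum]
  rw [integral_finsetSum t fun i hi => ((h i hi).cpow_smul hx).verticalIntegrable hσ,
    Finset.smul_sum]

theorem tendsto_intervalIntegral_horizontal (h : StripDecay F S) (h₁ : σ₁ ∈ S) (h₂ : σ₂ ∈ S)
    (hle : σ₁ ≤ σ₂) {l : Filter ℝ} (hl : Tendsto (fun T : ℝ => T ^ 2) l atTop) :
    Tendsto (fun T : ℝ => ∫ x in σ₁..σ₂, F (x + T * I)) l (𝓝 0) := by
  obtain ⟨C, hC⟩ := h.exists_bound σ₁ h₁ σ₂ h₂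
  have hdecay : Tendsto (fun T : ℝ => C * (1 + T ^ 2)⁻¹ * |σ₂ - σ₁|) l (𝓝 0) := by
    simpa using ((tendsto_atTop_add_const_left l 1 hl).inv_tendsto_atTop.const_mul C).mul_const
      |σ₂ - σ₁|
  refine squeeze_zero_norm (fun T => ?_) hdecay
  refine intervalIntegral.norm_integral_le_of_norm_le_const fun x hx => ?_
  rw [uIoc_of_le hle] at hx
  simpa using hC (x + T * I) (by simpa using ⟨hx.1.le, hx.2⟩)

theorem integral_vertical_eq_of_le [CompleteSpace E] [S.OrdConnected] (h : StripDecay F S)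
    (h₁ : σ₁ ∈ S) (h₂ : σ₂ ∈ S) (hle : σ₁ ≤ σ₂) :
    ∫ t : ℝ, F (σ₁ + t * I) = ∫ t : ℝ, F (σ₂ + t * I) := by
  have hvert : ∀ σ ∈ S, Tendsto (fun T : ℝ => ∫ t in (-T)..T, F (σ + t * I)) atTop
      (𝓝 (∫ t : ℝ, F (σ + t * I))) := fun σ hσ =>
    intervalIntegral_tendsto_integral (h.verticalIntegrable hσ) tendsto_neg_atTop_atBot tendsto_id
  have hsq : Tendsto (fun T : ℝ => T ^ 2) atTop atTop := tendsto_pow_atTop two_ne_zero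
  have htop := h.tendsto_intervalIntegral_horizontal h₁ h₂ hle hsq
  have hsq' : Tendsto (fun T : ℝ => T ^ 2) atBot atTop := by
    simpa [Function.comp_def] using hsq.comp tendsto_neg_atBot_atTop
  have hbot :=
    (h.tendsto_intervalIntegral_horizontal h₁ h₂ hle hsq').comp tendsto_neg_atTop_atBot
  have hrect : ∀ T : ℝ, (∫ x in σ₁..σ₂, F (x + (-T : ℝ) * I)) - (∫ x in σ₁..σ₂, F (x + T * I)) +
      I • (∫ t in (-T)..T, F (σ₂ + t * I)) - I • (∫ t in (-T)..T, F (σ₁ + t * I)) = 0 := by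
    intro T
    have hsub : uIcc σ₁ σ₂ ×ℂ uIcc (-T) T ⊆ re ⁻¹' S := fun s hs =>
      (inferInstance : S.OrdConnected).uIcc_subset h₁ h₂ hs.1
    simpa using integral_boundary_rect_eq_zero_of_differentiableOn F ⟨σ₁, -T⟩ ⟨σ₂, T⟩
      (h.differentiableOn.mono hsub)
  have hlim := tendsto_nhds_unique (((hbot.sub htop).add ((hvert σ₂ h₂).const_smul I)).sub
    ((hvert σ₁ h₁).const_smul I) |>.congr hrect) tendsto_const_nhds
  rw [sub_zero, zero_add, ← smul_sub, smul_eq_zero_iff_right I_ne_zero, sub_eq_zero] at hlim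
  exact hlim.symm

theorem mellinInv_eq [CompleteSpace E] [S.OrdConnected] (h : StripDecay F S) (h₁ : σ₁ ∈ S)
    (h₂ : σ₂ ∈ S) {x : ℝ} (hx : 0 < x) : mellinInv σ₁ F x = mellinInv σ₂ F x := by
  wlog hle : σ₁ ≤ σ₂ generalizing σ₁ σ₂
  · exact (this h₂ h₁ (le_of_not_ge hle)).symm
  · exact congrArg _ ((h.cpow_smul hx).integral_vertical_eq_of_le h₁ h₂ hle)

theorem mellinInv_isBigO_rpow [CompleteSpace E] [S.OrdConnected] (h : StripDecay F S)
    (h₁ : σ₁ ∈ S) (h₂ : σ₂ ∈ S) {l : Filter ℝ} (hl : ∀ᶠ x in l, 0 < x) :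
    mellinInv σ₁ F =O[l] fun x : ℝ => x ^ (-σ₂) := by
  refine Asymptotics.IsBigO.of_bound (1 / (2 * Real.pi) * ∫ t : ℝ, ‖F (σ₂ + t * I)‖)
    (hl.mono fun x hx => ?_)
  rw [h.mellinInv_eq h₁ h₂ hx, Real.norm_of_nonneg (Real.rpow_nonneg hx.le _)]
  exact norm_mellinInv_le σ₂ F hx

theorem mellinConvergent [CompleteSpace E] [S.OrdConnected] (h : StripDecay F S) (hS : IsOpen S)
    (hσ : σ ∈ S) {s : ℂ} (hs : s.re ∈ S) : MellinConvergent (mellinInv σ F) s := by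
  obtain ⟨l, u, ⟨hl, hu⟩, hsub⟩ := mem_nhds_iff_exists_Ioo_subset.1 (hS.mem_nhds hs)
  obtain ⟨b, hlb, hbs⟩ := exists_between hl
  obtain ⟨a, hsa, hau⟩ := exists_between hu
  exact mellinConvergent_of_isBigO_rpow
    ((continuousOn_mellinInv (h.verticalIntegrable hσ)).locallyIntegrableOn measurableSet_Ioi)
    (h.mellinInv_isBigO_rpow hσ (hsub ⟨hl.trans hsa, hau⟩) (eventually_gt_atTop 0)) hsa
    (h.mellinInv_isBigO_rpow hσ (hsub ⟨hlb, hbs.trans hu⟩) self_mem_nhdsWithin) hbs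

theorem mellin_mellinInv [CompleteSpace E] [S.OrdConnected] (h : StripDecay F S) (hS : IsOpen S)
    (hσ : σ ∈ S) {s : ℂ} (hs : s.re ∈ S) : mellin (mellinInv σ F) s = F s := by
  rw [← mellin_mellinInv_eq (h.verticalIntegrable hs) (h.continuous_vertical hs)
    (h.mellinConvergent hS hs (by simpa using hs))]
  exact setIntegral_congr_fun measurableSet_Ioi fun x hx =>
    congrArg _ (h.mellinInv_eq hσ hs hx)

end ContourShift

end StripDecay

end StripDecay

section GammaKernel

open Complex Set MeasureTheory Polynomial

theorem norm_Gamma_le_Gamma_re {s : ℂ} (hs : 0 < s.re) : ‖Gamma s‖ ≤ Real.Gamma s.re := by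
  rw [Gamma_eq_integral hs, Real.Gamma_eq_integral hs, GammaIntegral]
  refine (norm_integral_le_integral_norm _).trans_eq
    (setIntegral_congr_fun measurableSet_Ioi fun x hx => ?_)
  rw [norm_mul, norm_cpow_eq_rpow_re_of_pos hx, Complex.norm_of_nonneg (Real.exp_pos _).le,
    sub_re, one_re]

theorem inv_Gamma_eq_ascPochhammer_eval_mul (s : ℂ) (n : ℕ) :
    (Gamma s)⁻¹ = (ascPochhammer ℂ n).eval s * (Gamma (s + n))⁻¹ := by
  induction n with
  | zero => simp
  | succ n ih =>
    rw [ih, one_div_Gamma_eq_self_mul_one_div_Gamma_add_one, ascPochhammer_succ_eval]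
    push_cast
    ring_nf

theorem Gamma_add_natCast {s : ℂ} (hs : Gamma s ≠ 0) (n : ℕ) :
    Gamma (s + n) = (ascPochhammer ℂ n).eval s * Gamma s := by
  have h := inv_Gamma_eq_ascPochhammer_eval_mul s n
  have hn : Gamma (s + n) ≠ 0 := fun h0 => hs (by simpa [h0] using h)
  field_simp at h
  rw [h, mul_comm]

theorem exists_sum_smul_ascPochhammer_comp_eq {K : Type*} [Field K] (a : K) (p : K[X]) :
    ∃ d : ℕ → K, ∑ j ∈ Finset.Iic p.natDegree, d j • (ascPochhammer K j).comp (C a - X) = p := by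
  have hlin : (C a - X : K[X]).natDegree = 1 := by
    rw [natDegree_sub_eq_right_of_natDegree_lt (by simp), natDegree_X]
  let S : Polynomial.Sequence K :=
    ⟨fun j => (ascPochhammer K j).comp (C a - X), fun j => by
      have hj : (ascPochhammer K j).comp (C a - X) ≠ 0 := by
        rw [Ne, comp_eq_zero_iff]
        rintro (h | ⟨-, h⟩)
        · exact (monic_ascPochhammer K j).ne_zero h
        · rw [h, natDegree_C] at hlin
          exact zero_ne_one hlin
      rw [degree_eq_natDegree hj, natDegree_comp, hlin, mul_one, ascPochhammer_natDegree]⟩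
  have hspan : p ∈ Submodule.span K (S '' (Finset.Iic p.natDegree : Finset ℕ)) := by
    rw [Finset.coe_Iic, S.span_degreeLE fun i _ => (leadingCoeff_ne_zero.2 (S.ne_zero i)).isUnit,
      mem_degreeLE]
    exact degree_le_natDegree
  exact Submodule.mem_span_image_finset_iff_exists_fun' K |>.1 hspan

theorem differentiableOn_Gamma_re_pos : DifferentiableOn ℂ Gamma (re ⁻¹' Ioi 0) := fun s hs =>
  (differentiableAt_Gamma s fun m h =>
    (m.cast_nonneg (α := ℝ)).not_gt (by simpa [h] using hs)).differentiableWithinAt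

theorem one_add_im_sq_mul_norm_Gamma_le {s : ℂ} {c : ℝ} (hc : 0 < c) (hs : c ≤ s.re) :
    (1 + s.im ^ 2) * ‖Gamma s‖ ≤ (1 + (c ^ 2)⁻¹) * ‖Gamma (s + 2)‖ := by
  have hre : 0 < s.re := hc.trans_le hs
  have hs0 : s ≠ 0 := fun h => by simp [h] at hre
  have hs1 : s + 1 ≠ 0 := fun h => by
    have := congrArg re h
    simp only [add_re, one_re, zero_re] at this
    linarith
  have hnorm : ‖s‖ ^ 2 = s.re ^ 2 + s.im ^ 2 := by rw [Complex.sq_norm, normSq_apply]; ring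
  have hone : 1 ≤ (c ^ 2)⁻¹ * ‖s‖ ^ 2 := by
    rw [inv_mul_eq_div, one_le_div (by positivity)]
    nlinarith [sq_nonneg s.im]
  have hshift : ‖s‖ ≤ ‖s + 1‖ := by
    rw [← sq_le_sq₀ (norm_nonneg _) (norm_nonneg _), Complex.sq_norm, Complex.sq_norm,
      normSq_apply, normSq_apply]
    simp only [add_re, one_re, add_im, one_im, add_zero]
    nlinarith
  calc (1 + s.im ^ 2) * ‖Gamma s‖
      ≤ ((1 + (c ^ 2)⁻¹) * (‖s‖ * ‖s‖)) * ‖Gamma s‖ := by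
        gcongr
        nlinarith [sq_nonneg s.re]
    _ ≤ ((1 + (c ^ 2)⁻¹) * (‖s + 1‖ * ‖s‖)) * ‖Gamma s‖ := by gcongr
    _ = (1 + (c ^ 2)⁻¹) * ‖Gamma (s + 2)‖ := by
        rw [show s + 2 = s + 1 + 1 by ring, Gamma_add_one _ hs1, Gamma_add_one _ hs0, norm_mul,
          norm_mul]
        ring

theorem stripDecay_Gamma : StripDecay Gamma (Ioi 0) := by
  refine ⟨differentiableOn_Gamma_re_pos, fun c₁ h₁ c₂ _ => ?_⟩
  have hcont : ContinuousOn Real.Gamma (Icc (c₁ + 2) (c₂ + 2)) :=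
    Real.differentiableOn_Gamma_Ioi.continuousOn.mono fun x hx =>
      mem_Ioi.2 (by linarith [hx.1, mem_Ioi.1 h₁])
  obtain ⟨M, hM⟩ := isCompact_Icc.bddAbove_image hcont
  refine ⟨(1 + (c₁ ^ 2)⁻¹) * M, fun s hs => ?_⟩
  have hre : 0 < (s + 2).re := by
    rw [add_re, re_ofNat]
    linarith [hs.1, mem_Ioi.1 h₁]
  have hbound : ‖Gamma (s + 2)‖ ≤ M :=
    (norm_Gamma_le_Gamma_re hre).trans (hM (mem_image_of_mem _ (by simpa using hs)))
  rw [← div_eq_mul_inv, le_div_iff₀ (by positivity), mul_comm]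
  exact (one_add_im_sq_mul_norm_Gamma_le h₁ hs.1).trans (by gcongr)

variable {ι κ : Type*}

/-- The real parts of the vertical lines that separate the poles of the factors `Γ(b_j + s)` of the
product `gammaKernel a b` below from those of the factors `Γ(a_i - s)`. -/
def gammaStrip (a : ι → ℂ) (b : κ → ℂ) : Set ℝ :=
  {σ | (∀ j, 0 < (b j).re + σ) ∧ ∀ i, σ < (a i).re}

variable {a : ι → ℂ} {b : κ → ℂ}

instance ordConnected_gammaStrip : (gammaStrip a b).OrdConnected :=
  ⟨fun _ h₁ _ h₂ _ hσ => ⟨fun j => (h₁.1 j).trans_le (by gcongr; exact hσ.1),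
    fun i => hσ.2.trans_lt (h₂.2 i)⟩⟩

theorem gammaStrip_subset_update [DecidableEq ι] (i₀ : ι) (n : ℕ) :
    gammaStrip a b ⊆ gammaStrip (Function.update a i₀ (a i₀ + n)) b := by
  refine fun σ hσ => ⟨hσ.1, fun i => ?_⟩
  rcases eq_or_ne i i₀ with rfl | hi
  · simpa using (hσ.2 i).trans_le (le_add_of_nonneg_right n.cast_nonneg)
  · simpa [hi] using hσ.2 i

theorem isOpen_gammaStrip [Finite ι] [Finite κ] : IsOpen (gammaStrip a b) := by
  simp only [gammaStrip, ofPred_and, ofPred_forall]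
  exact (isOpen_iInter_of_finite fun j => isOpen_lt (by fun_prop) (by fun_prop)).inter
    (isOpen_iInter_of_finite fun i => isOpen_lt (by fun_prop) (by fun_prop))

variable [Fintype ι] [Fintype κ]

/-- The Gamma product `∏_j Γ(b_j + s) ∏_i Γ(a_i - s)`, the Mellin transform of a Meijer `G`-function
all of whose Gamma factors stand in the numerator. -/
noncomputable def gammaKernel (a : ι → ℂ) (b : κ → ℂ) (s : ℂ) : ℂ :=
  (∏ j, Gamma (b j + s)) * ∏ i, Gamma (a i - s)

theorem stripDecay_gammaKernel [Nonempty ι] (a : ι → ℂ) (b : κ → ℂ) :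
    StripDecay (gammaKernel a b) (gammaStrip a b) := by
  have hfactors : gammaKernel a b = fun s => ∏ x : κ ⊕ ι,
      Sum.elim (fun j s => Gamma (b j + s)) (fun i s => Gamma (a i - s)) x s := by
    ext s
    simp [gammaKernel, Fintype.prod_sum_type]
  rw [hfactors]
  refine StripDecay.prod Finset.univ_nonempty ?_
  rintro (j | i) -
  · exact (stripDecay_Gamma.comp_const_add (b j)).mono fun σ hσ => hσ.1 j
  · simpa [sub_eq_add_neg] using (stripDecay_Gamma.comp_const_add (a i)).comp_neg.mono
      fun σ hσ => lt_add_neg_iff_lt.2 (hσ.2 i)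

theorem gammaKernel_ne_zero {s : ℂ} (hs : s.re ∈ gammaStrip a b) : gammaKernel a b s ≠ 0 :=
  mul_ne_zero
    (Finset.prod_ne_zero_iff.2 fun j _ => Gamma_ne_zero_of_re_pos (by simpa using hs.1 j))
    (Finset.prod_ne_zero_iff.2 fun i _ => Gamma_ne_zero_of_re_pos (by simpa using hs.2 i))

theorem gammaKernel_update_add_natCast [DecidableEq ι] (i₀ : ι) (n : ℕ) {s : ℂ}
    (hs : s.re < (a i₀).re) :
    gammaKernel (Function.update a i₀ (a i₀ + n)) b s =
      (ascPochhammer ℂ n).eval (a i₀ - s) * gammaKernel a b s := by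
  have hGamma : Gamma (a i₀ + n - s) = (ascPochhammer ℂ n).eval (a i₀ - s) * Gamma (a i₀ - s) := by
    rw [← Gamma_add_natCast (Gamma_ne_zero_of_re_pos (by simpa using hs)), add_sub_right_comm]
  have hupdate : ∀ i, Gamma (Function.update a i₀ (a i₀ + n) i - s) =
      (if i = i₀ then (ascPochhammer ℂ n).eval (a i₀ - s) else 1) * Gamma (a i - s) := by
    intro i
    rcases eq_or_ne i i₀ with rfl | hi <;> simp [*]
  simp only [gammaKernel, hupdate, Finset.prod_mul_distrib, Finset.prod_ite_eq', Finset.mem_univ,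
    if_true]
  ring

theorem exists_eval_mul_gammaKernel_eq_sum [DecidableEq ι] (a : ι → ℂ) (b : κ → ℂ) (i₀ : ι)
    (p : ℂ[X]) :
    ∃ d : ℕ → ℂ, EqOn (fun s => p.eval s * gammaKernel a b s)
      (fun s => ∑ j ∈ Finset.Iic p.natDegree,
        d j • gammaKernel (Function.update a i₀ (a i₀ + j)) b s) (re ⁻¹' gammaStrip a b) := by
  obtain ⟨d, hd⟩ := exists_sum_smul_ascPochhammer_comp_eq (a i₀) p
  refine ⟨d, fun s hs => ?_⟩
  have heval := congrArg (eval s) hd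
  simp only [eval_finsetSum, eval_smul, eval_comp, eval_sub, eval_C, eval_X, smul_eq_mul] at heval
  simp only [gammaKernel_update_add_natCast i₀ _ (hs.2 i₀), ← heval, Finset.sum_mul, smul_eq_mul,
    mul_assoc]

theorem stripDecay_smul_gammaKernel_update [DecidableEq ι] (a : ι → ℂ) (b : κ → ℂ) (i₀ : ι)
    (d : ℂ) (j : ℕ) :
    StripDecay (fun s => d • gammaKernel (Function.update a i₀ (a i₀ + j)) b s)
      (gammaStrip a b) :=
  have : Nonempty ι := ⟨i₀⟩
  ((stripDecay_gammaKernel _ b).mono (gammaStrip_subset_update i₀ j)).const_smul d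

theorem stripDecay_eval_mul_gammaKernel [Nonempty ι] (a : ι → ℂ) (b : κ → ℂ) (p : ℂ[X]) :
    StripDecay (fun s => p.eval s * gammaKernel a b s) (gammaStrip a b) := by
  classical
  obtain ⟨i₀⟩ := ‹Nonempty ι›
  obtain ⟨d, hd⟩ := exists_eval_mul_gammaKernel_eq_sum a b i₀ p
  exact (StripDecay.sum fun j _ => stripDecay_smul_gammaKernel_update a b i₀ (d j) j).congr hd.symm

theorem exists_mellinInv_eval_mul_gammaKernel_eq_sum [DecidableEq ι] (a : ι → ℂ) (b : κ → ℂ)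
    (i₀ : ι) (p : ℂ[X]) :
    ∃ d : ℕ → ℂ, ∀ σ ∈ gammaStrip a b, ∀ x : ℝ, 0 < x →
      mellinInv σ (fun s => p.eval s * gammaKernel a b s) x =
        ∑ j ∈ Finset.Iic p.natDegree,
          d j * mellinInv σ (gammaKernel (Function.update a i₀ (a i₀ + j)) b) x := by
  obtain ⟨d, hd⟩ := exists_eval_mul_gammaKernel_eq_sum a b i₀ p
  refine ⟨d, fun σ hσ x hx => ?_⟩
  rw [mellinInv_congr (hd.mono (preimage_mono (singleton_subset_iff.2 hσ))),
    StripDecay.mellinInv_sum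
      (fun j _ => stripDecay_smul_gammaKernel_update a b i₀ (d j) j) hσ hx]
  exact Finset.sum_congr rfl fun j _ => mellinInv_const_smul σ (d j) _ x

end GammaKernel

section Determinants

open Equiv Matrix MeasureTheory

theorem perm_comp_inl_eq_inl_iff {κ η : Type*} [Finite κ] [Finite η] {σ : Perm (κ ⊕ η)} :
    σ ∘ Sum.inl = Sum.inl ↔ ∃ τ : Perm η, Perm.sumCongr 1 τ = σ := by
  refine ⟨fun h => ?_, by rintro ⟨τ, rfl⟩; ext i; simp⟩
  obtain ⟨⟨τ₁, τ⟩, rfl⟩ := Perm.mem_sumCongrHom_range_of_perm_mapsTo_inl (σ := σ) (by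
    rintro _ ⟨i, rfl⟩
    exact ⟨i, (congrFun h i).symm⟩)
  obtain rfl : τ₁ = 1 := Equiv.ext fun i => Sum.inl_injective (congrFun h i)
  exact ⟨τ, rfl⟩

variable {κ η ι R : Type*} [Fintype κ] [DecidableEq κ] [Fintype η] [DecidableEq η] [CommRing R]

theorem card_perm_comp_inl_eq {f : κ → κ ⊕ η} (hf : Function.Injective f) :
    (Finset.univ.filter fun σ : Perm (κ ⊕ η) => σ ∘ Sum.inl = f).card =
      (Fintype.card η).factorial := by
  obtain ⟨σ₀, hσ₀⟩ := Perm.exists_extending_pair (Sum.inl : κ → κ ⊕ η) f Sum.inl_injective hf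
  have hfiber : (Finset.univ.filter fun σ : Perm (κ ⊕ η) => σ ∘ Sum.inl = f) =
      Finset.univ.image fun τ : Perm η => σ₀ * Perm.sumCongr 1 τ := by
    ext σ
    have hσ : σ ∘ Sum.inl = f ↔ (σ₀⁻¹ * σ : Perm (κ ⊕ η)) ∘ Sum.inl = Sum.inl := by
      simp only [funext_iff, Function.comp_apply, Perm.mul_apply, Perm.inv_eq_iff_eq, hσ₀]
    simp only [Finset.mem_filter_univ, Finset.mem_image, Finset.mem_univ, true_and, hσ,
      perm_comp_inl_eq_inl_iff, eq_inv_mul_iff_mul_eq]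
  rw [hfiber, Finset.card_image_of_injective, Finset.card_univ, Fintype.card_perm]
  intro τ τ' h
  exact (Prod.ext_iff.1 (@Perm.sumCongrHom_injective κ η (1, τ) (1, τ') (mul_left_cancel h))).2

theorem sum_perm_comp_inl {F : (κ → κ ⊕ η) → R} (hF : ∀ f, ¬Function.Injective f → F f = 0) :
    ∑ σ : Perm (κ ⊕ η), F (σ ∘ Sum.inl) = (Fintype.card η).factorial * ∑ f, F f := by
  rw [← Finset.sum_fiberwise Finset.univ (fun σ : Perm (κ ⊕ η) => (σ ∘ Sum.inl : κ → κ ⊕ η)),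
    Finset.mul_sum]
  refine Finset.sum_congr rfl fun f _ => ?_
  rw [Finset.sum_congr rfl fun σ hσ => congrArg F (Finset.mem_filter.1 hσ).2, Finset.sum_const,
    nsmul_eq_mul]
  by_cases hf : Function.Injective f
  · rw [card_perm_comp_inl_eq hf]
  · rw [hF f hf, mul_zero, mul_zero]

theorem det_mul_det_eq_sum_perm (A B : Matrix κ κ R) :
    A.det * B.det = ∑ σ : Perm κ, (Matrix.of fun i j => A i (σ i) * B i (σ j)).det := by
  rw [← det_transpose A, det_apply', Finset.sum_mul]
  refine Finset.sum_congr rfl fun σ _ => ?_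
  have hcol := det_mul_column (fun i => A i (σ i)) (B.submatrix id σ)
  simp only [det_permute', submatrix_apply, id_eq] at hcol
  rw [hcol]
  simp only [transpose_apply]
  ring

theorem det_mul_comp_eq_zero_of_not_injective (v : κ → R) (B : κ → ι → R) {f : κ → ι}
    (hf : ¬Function.Injective f) : (Matrix.of fun i j => v i * B i (f j)).det = 0 := by
  obtain ⟨i, j, hij, hne⟩ := Function.not_injective_iff.1 hf
  exact det_zero_of_column_eq hne fun k => by simp only [of_apply, hij]

theorem det_sum_mul_eq_sum_det [Fintype ι] (A B : κ → ι → R) :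
    (Matrix.of fun i j => ∑ l, A i l * B j l).det =
      ∑ f : κ → ι, (Matrix.of fun i j => A i (f i) * B i (f j)).det := by
  have hterm : ∀ f : κ → ι, (Matrix.of fun i j => A i (f i) * B i (f j)).det =
      ∑ τ : Perm κ, (Perm.sign τ : R) * ∏ i, A i (f i) * B (τ i) (f i) := fun f => by
    refine (det_mul_column (fun i => A i (f i)) (Matrix.of fun i j => B i (f j))).trans ?_
    rw [det_apply', Finset.mul_sum]
    refine Finset.sum_congr rfl fun τ _ => ?_
    simp only [of_apply, Finset.prod_mul_distrib]
    ring
  simp_rw [hterm]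
  rw [Finset.sum_comm, ← det_transpose, det_apply']
  refine Finset.sum_congr rfl fun τ _ => ?_
  simp only [transpose_apply, of_apply, Fintype.prod_sum, Finset.mul_sum]

theorem det_sumElim_one (A : κ → κ ⊕ η → R) :
    (Matrix.of (Sum.elim A fun i j => if j = Sum.inr i then 1 else 0)).det =
      (Matrix.of fun i j => A i (Sum.inl j)).det := by
  have hblock : Matrix.of (Sum.elim A fun i j => if j = Sum.inr i then 1 else 0) =
      fromBlocks (Matrix.of fun i j => A i (Sum.inl j))
        (Matrix.of fun i j => A i (Sum.inr j)) 0 1 := by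
    ext (i | i) (j | j) <;> simp [one_apply, eq_comm]
  rw [hblock, det_fromBlocks_zero₂₁, det_one, mul_one]

theorem det_mul_det_sumElim_eq_sum {α : Type*} (P Q : κ ⊕ η → α → R) (x : κ → α) (y : η → α) :
    (Matrix.of fun i j => P j (Sum.elim x y i)).det *
        (Matrix.of fun i j => Q j (Sum.elim x y i)).det =
      ∑ σ : Perm (κ ⊕ η),
        (Matrix.of (Sum.elim (fun i j => P (σ (Sum.inl i)) (x i) * Q (σ j) (x i))
          fun i j => P (σ (Sum.inr i)) (y i) * Q (σ j) (y i))).det := by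
  rw [det_mul_det_eq_sum_perm]
  refine Finset.sum_congr rfl fun σ _ => congrArg det ?_
  ext (i | i) j <;> rfl

section Integrals

variable {𝕜 α : Type*} [RCLike 𝕜] [MeasurableSpace α] {m : Measure α} [SigmaFinite m]

theorem integrable_det_rows (A : κ → κ ⊕ η → 𝕜) {h : η → κ ⊕ η → α → 𝕜}
    (hint : ∀ i j, Integrable (h i j) m) :
    Integrable (fun y : η → α => (Matrix.of (Sum.elim A fun i j => h i j (y i))).det)
      (Measure.pi fun _ => m) := by
  simp_rw [← det_transpose (Matrix.of _), det_apply', transpose_apply, of_apply,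
    Fintype.prod_sum_type, Sum.elim_inl, Sum.elim_inr]
  exact integrable_finsetSum _ fun σ _ =>
    ((Integrable.fintype_prod fun i => hint i _).const_mul _).const_mul _

theorem integral_det_rows (A : κ → κ ⊕ η → 𝕜) {h : η → κ ⊕ η → α → 𝕜}
    (hint : ∀ i j, Integrable (h i j) m) :
    ∫ y : η → α, (Matrix.of (Sum.elim A fun i j => h i j (y i))).det ∂(Measure.pi fun _ => m) =
      (Matrix.of (Sum.elim A fun i j => ∫ t, h i j t ∂m)).det := by
  simp_rw [← det_transpose (Matrix.of _), det_apply', transpose_apply, of_apply,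
    Fintype.prod_sum_type, Sum.elim_inl, Sum.elim_inr]
  rw [integral_finsetSum _ fun σ _ =>
    ((Integrable.fintype_prod fun i => hint i _).const_mul _).const_mul _]
  refine Finset.sum_congr rfl fun σ _ => ?_
  rw [integral_const_mul, integral_const_mul, integral_fintype_prod_eq_prod]

variable {P Q : κ ⊕ η → α → 𝕜}

theorem integrable_det_mul_det (hint : ∀ i j, Integrable (fun t => P i t * Q j t) m) (x : κ → α) :
    Integrable (fun y : η → α => (Matrix.of fun i j => P j (Sum.elim x y i)).det *
        (Matrix.of fun i j => Q j (Sum.elim x y i)).det) (Measure.pi fun _ => m) := by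
  simp_rw [det_mul_det_sumElim_eq_sum]
  exact integrable_finsetSum _ fun σ _ => integrable_det_rows
    (h := fun i j t => P (σ (Sum.inr i)) t * Q (σ j) t) _ fun i j => hint _ _

theorem integral_det_mul_det (hint : ∀ i j, Integrable (fun t => P i t * Q j t) m)
    (hPQ : ∀ i j, ∫ t, P i t * Q j t ∂m = if i = j then 1 else 0) (x : κ → α) :
    ∫ y : η → α, (Matrix.of fun i j => P j (Sum.elim x y i)).det *
        (Matrix.of fun i j => Q j (Sum.elim x y i)).det ∂(Measure.pi fun _ => m) =
      (Fintype.card η).factorial * (Matrix.of fun i j => ∑ l, P l (x i) * Q l (x j)).det := by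
  let F (f : κ → κ ⊕ η) : 𝕜 := (Matrix.of fun i j => P (f i) (x i) * Q (f j) (x i)).det
  have hterm : ∀ σ : Perm (κ ⊕ η), ∫ y : η → α,
      (Matrix.of (Sum.elim (fun i j => P (σ (Sum.inl i)) (x i) * Q (σ j) (x i))
        fun i j => P (σ (Sum.inr i)) (y i) * Q (σ j) (y i))).det ∂(Measure.pi fun _ => m) =
      F (σ ∘ Sum.inl) := fun σ => by
    rw [integral_det_rows (h := fun i j t => P (σ (Sum.inr i)) t * Q (σ j) t) _
      fun i j => hint _ _]
    simp_rw [hPQ, σ.injective.eq_iff, eq_comm (a := Sum.inr _)]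
    exact det_sumElim_one _
  simp_rw [det_mul_det_sumElim_eq_sum]
  rw [integral_finsetSum _ fun σ _ => integrable_det_rows
    (h := fun i j t => P (σ (Sum.inr i)) t * Q (σ j) t) _ fun i j => hint _ _,
    Finset.sum_congr rfl fun σ _ => hterm σ, sum_perm_comp_inl fun f hf =>
      det_mul_comp_eq_zero_of_not_injective (fun i => P (f i) (x i)) (fun i l => Q l (x i)) hf,
    det_sum_mul_eq_sum_det (fun i l => P l (x i)) fun i l => Q l (x i)]

end Integrals

end Determinants

section TriangularFactorization

open Matrix

variable {n R : Type*} [LinearOrder n]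

theorem eq_diagonal_of_isUpperTriangular_of_isLowerTriangular [Zero R] {X : Matrix n n R}
    (hu : X.IsUpperTriangular) (hl : X.IsLowerTriangular) : X = diagonal X.diag := by
  ext i j
  rcases lt_trichotomy i j with hij | rfl | hij
  · rw [diagonal_apply_ne _ hij.ne, hl (OrderDual.toDual_lt_toDual.2 hij)]
  · rw [diagonal_apply_eq, diag_apply]
  · rw [diagonal_apply_ne _ hij.ne', hu hij]

theorem eq_and_eq_of_unitriangular_mul_lower_eq [Fintype n] [CommRing R]
    {U U' L L' : Matrix n n R} (hU : U.IsUpperTriangular) (hU₁ : ∀ i, U i i = 1)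
    (hU' : U'.IsUpperTriangular) (hU'₁ : ∀ i, U' i i = 1)
    (hL : L.IsLowerTriangular) (hL' : L'.IsLowerTriangular)
    (hL₁ : IsUnit L.det) (h : U * L = U' * L') : U = U' ∧ L = L' := by
  have hUdet : IsUnit U'.det := by simp [det_of_isUpperTriangular hU', hU'₁]
  let _ := invertibleOfIsUnitDet L hL₁
  let _ := invertibleOfIsUnitDet U' hUdet
  have hX : U'⁻¹ * U = L' * L⁻¹ := by
    rw [← inv_mul_cancel_left_of_invertible U' (L' * L⁻¹), ← Matrix.mul_assoc U', ← h,
      mul_inv_cancel_right_of_invertible]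
  have hdiag := eq_diagonal_of_isUpperTriangular_of_isLowerTriangular
    ((blockTriangular_inv_of_blockTriangular hU').mul hU)
    (hX ▸ hL'.mul (blockTriangular_inv_of_blockTriangular hL))
  have hmul : U = U' * (U'⁻¹ * U) := (mul_inv_cancel_left_of_invertible U' U).symm
  have hone : (U'⁻¹ * U).diag = 1 := by
    ext i
    have hii : U i i = (U' * (U'⁻¹ * U)) i i := congrFun₂ hmul i i
    rw [hdiag, mul_diagonal, hU₁, hU'₁, one_mul] at hii
    exact hii.symm
  rw [hone, Pi.one_def, diagonal_one] at hdiag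
  refine ⟨by rw [hmul, hdiag, Matrix.mul_one], ?_⟩
  rw [← Matrix.one_mul L, ← hdiag, hX, inv_mul_cancel_right_of_invertible]

end TriangularFactorization

section BiorthogonalEnsembles

open Matrix MeasureTheory Set

theorem posOrthant_eq_pi (m : ℕ) : posOrthant m = Set.pi univ fun _ => Ioi 0 := by
  ext y
  simp only [posOrthant, mem_ofPred_eq, mem_univ_pi, mem_Ioi]

theorem measurableSet_posOrthant (m : ℕ) : MeasurableSet (posOrthant m) :=
  posOrthant_eq_pi m ▸ MeasurableSet.univ_pi fun _ => measurableSet_Ioi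

theorem volume_restrict_posOrthant (m : ℕ) :
    (volume : Measure (Fin m → ℝ)).restrict (posOrthant m) =
      Measure.pi fun _ => (volume : Measure ℝ).restrict (Ioi 0) := by
  rw [← Measure.restrict_pi_pi, ← volume_pi, posOrthant_eq_pi]

theorem sumElim_comp_symm_eq_joinCoords {N k : ℕ} (hk : k ≤ N) (x : Fin k → ℝ)
    (y : Fin (N - k) → ℝ) :
    Sum.elim x y ∘ (finSumFinEquiv.trans (finCongr (Nat.add_sub_of_le hk))).symm =
      joinCoords x y := by
  rw [Equiv.comp_symm_eq]
  ext (i | i) <;> simp [joinCoords]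

variable {N : ℕ} {φ P Q P' Q' : Fin N → ℝ → ℂ}

/-- The moments `∫_0^∞ x^k φ_j(x) dx`, `0 ≤ j, k < N`: the Gram matrix of the functions `φ_j` and
the monomials. -/
noncomputable def momentMatrix (φ : Fin N → ℝ → ℂ) : Matrix (Fin N) (Fin N) ℂ :=
  Matrix.of fun j k => ∫ x in Ioi (0 : ℝ), (x : ℂ) ^ (k : ℕ) * φ j x

namespace IsBiorthogonalSystem

variable (h : IsBiorthogonalSystem φ P Q)

include h

theorem exists_lower : ∃ L : Matrix (Fin N) (Fin N) ℂ, L.IsLowerTriangular ∧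
      ∀ l, ∀ x : ℝ, 0 < x → Q l x = ∑ j, L l j * φ j x := by
  choose d hd using h.span
  refine ⟨Matrix.of fun l j => if j ≤ l then d l j else 0, fun i j hij => ?_, fun l x hx => ?_⟩
  · exact if_neg (not_le.2 (OrderDual.toDual_lt_toDual.1 hij))
  · simp only [hd l x hx, of_apply, ite_mul, zero_mul, ← Finset.sum_filter, ← Finset.mem_Iic,
      Finset.filter_univ_mem]

theorem exists_unitriangular :
    ∃ U : Matrix (Fin N) (Fin N) ℂ, U.IsUpperTriangular ∧ (∀ n, U n n = 1) ∧
      ∀ n, ∀ x : ℝ, P n x = ∑ k, U k n * (x : ℂ) ^ (k : ℕ) := by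
  choose q hmonic hdeg heval using h.monic
  refine ⟨Matrix.of fun k n => (q n).coeff k, fun k n hkn => ?_, fun n => ?_, fun n x => ?_⟩
  · exact Polynomial.coeff_eq_zero_of_natDegree_lt ((hdeg n).trans_lt hkn)
  · rw [of_apply, ← hdeg, (hmonic n).coeff_natDegree]
  · rw [heval, Polynomial.eval_eq_sum_range' ((hdeg n).trans_lt n.isLt), ← Fin.sum_univ_eq_sum_range
      fun k => (q n).coeff k * (x : ℂ) ^ k]
    rfl

theorem prod_sub_eq_det (x : Fin N → ℝ) :
    ∏ j : Fin N, ∏ k ∈ Finset.Ioi j, ((x k : ℂ) - (x j : ℂ)) =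
      (Matrix.of fun i j => P j (x i)).det := by
  choose q hmonic hdeg heval using h.monic
  rw [← det_vandermonde (fun i => (x i : ℂ)),
    det_eval_matrixOfPolynomials_eq_det_vandermonde _ q hdeg hmonic]
  simp_rw [heval]

variable (hφ : ∀ k j : Fin N, IntegrableOn (fun x : ℝ => (x : ℂ) ^ (k : ℕ) * φ j x) (Ioi 0))

include hφ

theorem mul_momentMatrix_mul_eq_one {L U : Matrix (Fin N) (Fin N) ℂ}
    (hL : ∀ l, ∀ x : ℝ, 0 < x → Q l x = ∑ j, L l j * φ j x)
    (hU : ∀ n, ∀ x : ℝ, P n x = ∑ k, U k n * (x : ℂ) ^ (k : ℕ)) :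
    L * momentMatrix φ * U = 1 := by
  ext l n
  have hexp : ∀ x ∈ Ioi (0 : ℝ), P n x * Q l x =
      ∑ k, ∑ j, (U k n * L l j) * ((x : ℂ) ^ (k : ℕ) * φ j x) := fun x hx => by
    rw [hU, hL l x hx, Finset.sum_mul_sum]
    exact Finset.sum_congr rfl fun k _ => Finset.sum_congr rfl fun j _ => mul_mul_mul_comm ..
  have hbi := h.biorthogonal n l
  rw [setIntegral_congr_fun measurableSet_Ioi hexp, integral_finsetSum _ fun k _ =>
    integrable_finsetSum _ fun j _ => (hφ k j).const_mul _] at hbi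
  simp_rw [one_apply, eq_comm (a := l), ← hbi, Matrix.mul_apply, Finset.sum_mul]
  refine Finset.sum_congr rfl fun k _ => ?_
  rw [integral_finsetSum _ fun j _ => (hφ k j).const_mul _]
  refine Finset.sum_congr rfl fun j _ => ?_
  rw [integral_const_mul, momentMatrix, of_apply]
  ring

theorem unique (h' : IsBiorthogonalSystem φ P' Q') (n : Fin N) :
    (∀ x : ℝ, P' n x = P n x) ∧ (∀ x : ℝ, 0 < x → Q' n x = Q n x) := by
  obtain ⟨L, hLt, hL⟩ := h.exists_lower
  obtain ⟨U, hUt, hU₁, hU⟩ := h.exists_unitriangular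
  obtain ⟨L', hLt', hL'⟩ := h'.exists_lower
  obtain ⟨U', hUt', hU₁', hU'⟩ := h'.exists_unitriangular
  have hLGU := h.mul_momentMatrix_mul_eq_one hφ hL hU
  have hLGU' := h'.mul_momentMatrix_mul_eq_one hφ hL' hU'
  have hinv : U * L * momentMatrix φ = 1 := by
    rw [Matrix.mul_assoc, mul_eq_one_comm, hLGU]
  have hinv' : momentMatrix φ * (U' * L') = 1 := by
    rw [← Matrix.mul_assoc, mul_eq_one_comm, ← Matrix.mul_assoc, hLGU']
  have hLdet : IsUnit L.det :=
    isUnit_det_of_right_inverse ((Matrix.mul_assoc _ _ _).symm.trans hLGU)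
  obtain ⟨rfl, rfl⟩ := eq_and_eq_of_unitriangular_mul_lower_eq hUt hU₁ hUt' hU₁' hLt hLt' hLdet
    (left_inv_eq_right_inv hinv hinv')
  exact ⟨fun x => by rw [hU, hU'], fun x hx => by rw [hL n x hx, hL' n x hx]⟩

theorem det_mul_det_momentMatrix {L : Matrix (Fin N) (Fin N) ℂ}
    (hL : ∀ l, ∀ x : ℝ, 0 < x → Q l x = ∑ j, L l j * φ j x) :
    L.det * (momentMatrix φ).det = 1 := by
  obtain ⟨U, hUt, hU₁, hU⟩ := h.exists_unitriangular
  simpa [det_of_isUpperTriangular hUt, hU₁] using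
    congrArg det (h.mul_momentMatrix_mul_eq_one hφ hL hU)

theorem det_momentMatrix_ne_zero : (momentMatrix φ).det ≠ 0 := by
  obtain ⟨L, -, hL⟩ := h.exists_lower
  exact right_ne_zero_of_mul_eq_one (h.det_mul_det_momentMatrix hφ hL)

theorem ensembleWeight_eq {x : Fin N → ℝ} (hx : x ∈ posOrthant N) :
    ensembleWeight φ x = (momentMatrix φ).det * ((Matrix.of fun i j => P j (x i)).det *
      (Matrix.of fun i j => Q j (x i)).det) := by
  obtain ⟨L, -, hL⟩ := h.exists_lower
  have hQ : (Matrix.of fun i j => Q j (x i)).det =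
      L.det * (Matrix.of fun j k : Fin N => φ j (x k)).det := by
    rw [← det_mul, ← det_transpose]
    refine congrArg det (Matrix.ext fun l k => ?_)
    rw [transpose_apply, of_apply, hL l _ (hx k), Matrix.mul_apply]
    rfl
  rw [ensembleWeight, h.prod_sub_eq_det, hQ]
  linear_combination -(Matrix.of fun i j => P j (x i)).det *
    (Matrix.of fun j k => φ j (x k)).det * h.det_mul_det_momentMatrix hφ hL

theorem ensembleWeight_sumElim_eq {k m : ℕ} (e : Fin k ⊕ Fin m ≃ Fin N) {x : Fin k → ℝ}
    (hx : ∀ i, 0 < x i) {y : Fin m → ℝ} (hy : y ∈ posOrthant m) :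
    ensembleWeight φ (Sum.elim x y ∘ e.symm) =
      (momentMatrix φ).det * ((Matrix.of fun i j => P (e j) (Sum.elim x y i)).det *
        (Matrix.of fun i j => Q (e j) (Sum.elim x y i)).det) := by
  have hxy : Sum.elim x y ∘ e.symm ∈ posOrthant N := fun i =>
    Sum.rec (motive := fun j => 0 < Sum.elim x y j) hx hy (e.symm i)
  rw [h.ensembleWeight_eq hφ hxy,
    ← det_submatrix_equiv_self e (Matrix.of fun i j => P j ((Sum.elim x y ∘ e.symm) i)),
    ← det_submatrix_equiv_self e (Matrix.of fun i j => Q j ((Sum.elim x y ∘ e.symm) i))]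
  simp only [submatrix, of_apply, Function.comp_apply, Equiv.symm_apply_apply]

theorem integrableOn_ensembleWeight_sumElim {k m : ℕ} (e : Fin k ⊕ Fin m ≃ Fin N)
    {x : Fin k → ℝ} (hx : ∀ i, 0 < x i) :
    IntegrableOn (fun y => ensembleWeight φ (Sum.elim x y ∘ e.symm)) (posOrthant m) := by
  refine IntegrableOn.congr_fun ?_ (fun y hy => (h.ensembleWeight_sumElim_eq hφ e hx hy).symm)
    (measurableSet_posOrthant m)
  rw [IntegrableOn, volume_restrict_posOrthant]
  exact (integrable_det_mul_det (fun i j => h.integrable (e i) (e j)) x).const_mul _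

theorem integral_ensembleWeight_sumElim {k m : ℕ} (e : Fin k ⊕ Fin m ≃ Fin N)
    {x : Fin k → ℝ} (hx : ∀ i, 0 < x i) :
    ∫ y in posOrthant m, ensembleWeight φ (Sum.elim x y ∘ e.symm) =
      (momentMatrix φ).det * (m.factorial *
        (Matrix.of fun i j => biorthogonalKernel P Q (x i) (x j)).det) := by
  have hkernel : ∀ i j, ∑ l, P (e l) (x i) * Q (e l) (x j) =
      biorthogonalKernel P Q (x i) (x j) := fun i j =>
    e.sum_comp fun l => P l (x i) * Q l (x j)
  rw [setIntegral_congr_fun (measurableSet_posOrthant m) fun y hy =>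
      h.ensembleWeight_sumElim_eq hφ e hx hy, volume_restrict_posOrthant, integral_const_mul,
    integral_det_mul_det (P := fun i => P (e i)) (Q := fun i => Q (e i))
      (fun i j => h.integrable (e i) (e j))
      (fun i j => by simp only [h.biorthogonal, e.injective.eq_iff]), Fintype.card_fin]
  simp_rw [hkernel]

theorem integrableOn_ensembleWeight : IntegrableOn (ensembleWeight φ) (posOrthant N) :=
  h.integrableOn_ensembleWeight_sumElim hφ (Equiv.emptySum (Fin 0) (Fin N)) (x := Fin.elim0)
    fun i => i.elim0

theorem integral_ensembleWeight :
    ∫ x in posOrthant N, ensembleWeight φ x = (momentMatrix φ).det * N.factorial := by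
  have hint := h.integral_ensembleWeight_sumElim hφ (Equiv.emptySum (Fin 0) (Fin N))
    (x := Fin.elim0) fun i => i.elim0
  rwa [det_fin_zero, mul_one] at hint

theorem integral_ensembleWeight_ne_zero :
    ∫ x in posOrthant N, ensembleWeight φ x ≠ 0 := by
  rw [h.integral_ensembleWeight hφ]
  exact mul_ne_zero (h.det_momentMatrix_ne_zero hφ)
    (Nat.cast_ne_zero.2 N.factorial_ne_zero)

theorem correlationFunction_ensembleWeight {k : ℕ} (hk : k ≤ N) {x : Fin k → ℝ}
    (hx : ∀ i, 0 < x i) :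
    correlationFunction (ensembleWeight φ) k x =
      (Matrix.of fun i j : Fin k => biorthogonalKernel P Q (x i) (x j)).det := by
  have hZ := h.integral_ensembleWeight_ne_zero hφ
  have hint := h.integral_ensembleWeight_sumElim hφ
    (finSumFinEquiv.trans (finCongr (Nat.add_sub_of_le hk))) hx
  simp_rw [sumElim_comp_symm_eq_joinCoords hk] at hint
  rw [h.integral_ensembleWeight hφ] at hZ
  rw [correlationFunction, integral_div, hint, h.integral_ensembleWeight hφ]
  have hfac : ((N - k).factorial : ℂ) ≠ 0 := Nat.cast_ne_zero.2 (N - k).factorial_ne_zero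
  have hdet := left_ne_zero_of_mul hZ
  have hN := right_ne_zero_of_mul hZ
  field_simp

end IsBiorthogonalSystem

end BiorthogonalEnsembles

section MeijerG

open Complex Set MeasureTheory Polynomial

theorem verticalIntegrable_comp_neg_iff {E : Type*} [NormedAddCommGroup E] {F : ℂ → E} {c : ℝ} :
    VerticalIntegrable (fun s => F (-s)) (-c) ↔ VerticalIntegrable F c := by
  unfold VerticalIntegrable
  rw [← (Measure.measurePreserving_neg volume).integrable_comp_emb
    (MeasurableEquiv.neg ℝ).measurableEmbedding (g := fun y : ℝ => F (c + y * I))]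
  simp [Function.comp_def, add_comm]

theorem meijerG_eq_mellinInv (c : ℝ) (m n : ℕ) {p q : ℕ} (a : Fin p → ℂ) (b : Fin q → ℂ) (x : ℝ) :
    meijerG c m n a b x = mellinInv (-c) (fun s => meijerKernel m n a b (-s)) x := by
  rw [meijerG, mellinInv, integral_mul_const, ← integral_neg_eq_self, real_smul]
  simp only [ofReal_neg, neg_mul, neg_add_rev, neg_neg, smul_eq_mul,
    mul_comm (meijerKernel _ _ _ _ _), add_comm (c : ℂ)]
  push_cast
  field_simp

variable {p q : ℕ} {a : Fin p → ℂ} {b : Fin q → ℂ} {c : ℝ}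

theorem meijerKernel_neg (a : Fin p → ℂ) (b : Fin q → ℂ) (s : ℂ) :
    meijerKernel q p a b (-s) = gammaKernel (fun i => 1 - a i) b s := by
  have hlt : ∀ {n : ℕ} (i : Fin n), ¬n ≤ i.val := fun i => i.is_lt.not_ge
  simp [meijerKernel, gammaKernel, hlt, sub_eq_add_neg]

theorem separatesPoles_iff :
    SeparatesPoles c q p a b ↔ -c ∈ gammaStrip (fun i => 1 - a i) b := by
  simp only [SeparatesPoles, gammaStrip, Fin.is_lt, true_imp_iff, mem_ofPred_eq, sub_re, one_re,
    ← sub_eq_add_neg, sub_pos]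
  simp only [neg_lt_sub_iff_lt_add, sub_lt_iff_lt_add]

theorem separatesPoles_snoc_cons_iff {d e : ℂ} :
    SeparatesPoles c (q + 1) p (Fin.snoc a d : Fin (p + 1) → ℂ) (Fin.cons e b : Fin (q + 1) → ℂ) ↔
      c < e.re ∧ -c ∈ gammaStrip (fun i => 1 - a i) b := by
  rw [← separatesPoles_iff, SeparatesPoles, Fin.forall_fin_succ, Fin.forall_fin_succ' (n := p)]
  simp [SeparatesPoles, and_assoc]

theorem meijerKernel_snoc_cons_zero_neg (a : Fin p → ℂ) (b : Fin q → ℂ) (l : ℕ) {s : ℂ}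
    (hs : 0 < s.re) :
    meijerKernel (q + 1) p (Fin.snoc a (-(l : ℂ)) : Fin (p + 1) → ℂ)
        (Fin.cons 0 b : Fin (q + 1) → ℂ) (-s) =
      ((descPochhammer ℂ l).comp (X - 1)).eval s * gammaKernel (fun i => 1 - a i) b s := by
  have hGamma : Gamma s * (Gamma (s - l))⁻¹ = (descPochhammer ℂ l).eval (s - 1) := by
    rw [inv_Gamma_eq_ascPochhammer_eval_mul _ l, descPochhammer_eval_eq_ascPochhammer,
      sub_add_cancel, mul_left_comm, mul_inv_cancel₀ (Gamma_ne_zero_of_re_pos hs), mul_one]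
    ring_nf
  have hkernel : meijerKernel (q + 1) p (Fin.snoc a (-(l : ℂ)) : Fin (p + 1) → ℂ)
        (Fin.cons 0 b : Fin (q + 1) → ℂ) (-s) =
      Gamma s * (Gamma (s - l))⁻¹ * meijerKernel q p a b (-s) := by
    have hlt : ∀ {n : ℕ} (i : Fin n), ¬n ≤ i.val := fun i => i.is_lt.not_ge
    simp only [meijerKernel, Finset.prod_filter, Fin.prod_univ_succ (n := q),
      Fin.prod_univ_castSucc (n := p), Fin.cons_zero, Fin.cons_succ, Fin.snoc_castSucc,
      Fin.snoc_last]
    simp [hlt, div_eq_mul_inv, neg_add_eq_sub]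
    ring
  rw [hkernel, hGamma, meijerKernel_neg, eval_comp, eval_sub, eval_X, eval_one]

end MeijerG

section MomentPolynomials

open MeasureTheory Polynomial Set
open scoped fwdDiff

theorem sum_neg_one_pow_mul_choose_mul_choose (R : Type*) [CommRing R] (n l : ℕ) :
    ∑ k ∈ Finset.range (n + 1), (-1 : R) ^ (n + k) * n.choose k * k.choose l =
      if n = l then 1 else 0 := by
  have h := fwdDiff_iter_choose_zero l n
  rw [fwdDiff_iter_eq_sum_shift] at h
  have hR := congrArg (Int.cast : ℤ → R) h
  push_cast [smul_eq_mul, mul_one, zero_add, zsmul_eq_mul] at hR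
  rw [← hR]
  refine Finset.sum_congr rfl fun k hk => ?_
  have hkn : k ≤ n := Nat.lt_succ_iff.1 (Finset.mem_range.1 hk)
  rw [show n + k = n - k + 2 * k by omega, pow_add, pow_mul, neg_one_sq, one_pow, mul_one]

/-- The polynomial `∑_k (-1)^(n+k) C(n,k) (m_n / m_k) X^k`, the monic polynomial of degree `n`
orthogonal to every functional `X^k ↦ C(k,l) m_k` with `l ≠ n`. -/
noncomputable def momentPolynomial {K : Type*} [Field K] (m : ℕ → K) (n : ℕ) : K[X] :=
  ∑ k ∈ Finset.range (n + 1), monomial k ((-1) ^ (n + k) * n.choose k * (m n / m k))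

section Field

variable {K : Type*} [Field K] {m : ℕ → K} {n : ℕ}

theorem coeff_momentPolynomial (m : ℕ → K) (n k : ℕ) :
    (momentPolynomial m n).coeff k = (-1) ^ (n + k) * n.choose k * (m n / m k) := by
  simp only [momentPolynomial, finsetSum_coeff, coeff_monomial, Finset.sum_ite_eq',
    Finset.mem_range, Nat.lt_succ_iff]
  split_ifs with hk
  · rfl
  · simp [Nat.choose_eq_zero_of_lt (not_le.1 hk)]

theorem coeff_momentPolynomial_self (hn : m n ≠ 0) : (momentPolynomial m n).coeff n = 1 := by
  simp [coeff_momentPolynomial, hn, ← two_mul]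

theorem natDegree_momentPolynomial_le (m : ℕ → K) (n : ℕ) :
    (momentPolynomial m n).natDegree ≤ n :=
  natDegree_sum_le_of_forall_le _ _ fun _ hk =>
    (natDegree_monomial_le _).trans (Nat.lt_succ_iff.1 (Finset.mem_range.1 hk))

theorem natDegree_momentPolynomial (hn : m n ≠ 0) : (momentPolynomial m n).natDegree = n :=
  natDegree_eq_of_le_of_coeff_ne_zero (natDegree_momentPolynomial_le m n)
    (by rw [coeff_momentPolynomial_self hn]; exact one_ne_zero)

theorem monic_momentPolynomial (hn : m n ≠ 0) : (momentPolynomial m n).Monic :=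
  monic_of_natDegree_le_of_coeff_eq_one n (natDegree_momentPolynomial_le m n)
    (coeff_momentPolynomial_self hn)

theorem sum_coeff_momentPolynomial_mul_choose (hm : ∀ k ≤ n, m k ≠ 0) (l : ℕ) :
    ∑ k ∈ Finset.range (n + 1), (momentPolynomial m n).coeff k * (k.choose l * (m k / m l)) =
      if n = l then 1 else 0 := by
  have hterm : ∀ k ∈ Finset.range (n + 1),
      (momentPolynomial m n).coeff k * (k.choose l * (m k / m l)) =
        (-1) ^ (n + k) * n.choose k * k.choose l * (m n / m l) := fun k hk => by
    have hk := hm k (Nat.lt_succ_iff.1 (Finset.mem_range.1 hk))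
    rw [coeff_momentPolynomial]
    field_simp
  rw [Finset.sum_congr rfl hterm, ← Finset.sum_mul, sum_neg_one_pow_mul_choose_mul_choose]
  split_ifs with hnl
  · rw [← hnl, div_self (hm n le_rfl), one_mul]
  · rw [zero_mul]

end Field

variable {μ : Measure ℝ} {f : ℝ → ℂ} {p : ℂ[X]} {n : ℕ}

theorem eval_ofReal_mul_eq_sum (hp : p.natDegree ≤ n) (z : ℂ) (x : ℝ) :
    p.eval (x : ℂ) * z = ∑ k ∈ Finset.range (n + 1), p.coeff k * ((x : ℂ) ^ k * z) := by
  rw [eval_eq_sum_range' (Nat.lt_succ_iff.2 hp), Finset.sum_mul]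
  exact Finset.sum_congr rfl fun k _ => mul_assoc _ _ _

theorem integrable_eval_ofReal_mul (hp : p.natDegree ≤ n)
    (hf : ∀ k ≤ n, Integrable (fun x : ℝ => (x : ℂ) ^ k * f x) μ) :
    Integrable (fun x : ℝ => p.eval (x : ℂ) * f x) μ := by
  simp only [eval_ofReal_mul_eq_sum hp]
  exact integrable_finsetSum _ fun k hk =>
    (hf k (Nat.lt_succ_iff.1 (Finset.mem_range.1 hk))).const_mul _

theorem integral_eval_ofReal_mul (hp : p.natDegree ≤ n)
    (hf : ∀ k ≤ n, Integrable (fun x : ℝ => (x : ℂ) ^ k * f x) μ) :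
    ∫ x, p.eval (x : ℂ) * f x ∂μ =
      ∑ k ∈ Finset.range (n + 1), p.coeff k * ∫ x, (x : ℂ) ^ k * f x ∂μ := by
  simp only [eval_ofReal_mul_eq_sum hp]
  rw [integral_finsetSum _ fun k hk =>
    (hf k (Nat.lt_succ_iff.1 (Finset.mem_range.1 hk))).const_mul _]
  simp only [integral_const_mul]

end MomentPolynomials

section TerminatingSeries

open Complex Polynomial

theorem hypergeomPFQ_cons_neg_natCast {p q : ℕ} (n : ℕ) (a : Fin p → ℂ) (b : Fin q → ℂ) (x : ℂ) :
    hypergeomPFQ (Fin.cons (-(n : ℂ)) a : Fin (p + 1) → ℂ) b x =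
      ∑ k ∈ Finset.range (n + 1), (-1) ^ k * n.choose k *
        ((∏ i, (ascPochhammer ℂ k).eval (a i)) / ∏ j, (ascPochhammer ℂ k).eval (b j)) * x ^ k := by
  simp only [hypergeomPFQ, Fin.prod_univ_succ (n := p), Fin.cons_zero, Fin.cons_succ]
  rw [tsum_eq_sum (s := Finset.range (n + 1))]
  · refine Finset.sum_congr rfl fun k _ => ?_
    have hfac : (k.factorial : ℂ) ≠ 0 := Nat.cast_ne_zero.2 k.factorial_ne_zero
    rw [ascPochhammer_eval_neg_eq_descPochhammer, descPochhammer_eval_eq_descFactorial,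
      Nat.descFactorial_eq_factorial_mul_choose]
    push_cast
    field_simp
  · intro k hk
    have hnk : n < k := by simpa [Nat.lt_succ_iff] using hk
    rw [ascPochhammer_eval_neg_coe_nat_of_lt hnk, zero_mul, zero_div, zero_mul]

theorem ascPochhammer_eval_one_sub_mul_Gamma_sub {s : ℂ} {n : ℕ} (hs : Gamma (s - n) ≠ 0) :
    (ascPochhammer ℂ n).eval (1 - s) * Gamma (s - n) = (-1) ^ n * Gamma s := by
  have hGamma := Gamma_add_natCast hs n
  rw [sub_add_cancel] at hGamma
  rw [hGamma, ← neg_sub s 1, ascPochhammer_eval_neg_eq_descPochhammer,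
    descPochhammer_eval_eq_ascPochhammer, show s - 1 - n + 1 = s - n by ring, mul_assoc]

variable {ι κ : Type*} [Fintype ι] [Fintype κ] {a : ι → ℂ} {b : κ → ℂ}

theorem prod_ascPochhammer_mul_gammaKernel_add_natCast {s : ℂ} {n : ℕ}
    (hs : s.re ∈ gammaStrip a b) (hsn : (s + n).re ∈ gammaStrip a b) :
    (∏ i, (ascPochhammer ℂ n).eval (1 + s - a i)) * gammaKernel a b (s + n) =
      ((-1) ^ n) ^ Fintype.card ι * (∏ j, (ascPochhammer ℂ n).eval (b j + s)) *
        gammaKernel a b s := by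
  have hupper : ∀ i, (ascPochhammer ℂ n).eval (1 + s - a i) * Gamma (a i - (s + n)) =
      (-1) ^ n * Gamma (a i - s) := fun i => by
    have hne : Gamma (a i - (s + n)) ≠ 0 :=
      Gamma_ne_zero_of_re_pos (by simpa using hsn.2 i)
    rw [← sub_sub] at hne ⊢
    rw [← ascPochhammer_eval_one_sub_mul_Gamma_sub hne, sub_sub_eq_add_sub]
  have hlower : ∀ j, Gamma (b j + (s + n)) = (ascPochhammer ℂ n).eval (b j + s) *
      Gamma (b j + s) := fun j => by
    rw [← add_assoc, Gamma_add_natCast (Gamma_ne_zero_of_re_pos (by simpa using hs.1 j))]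
  calc (∏ i, (ascPochhammer ℂ n).eval (1 + s - a i)) * gammaKernel a b (s + n)
      = (∏ j, Gamma (b j + (s + n))) *
          ∏ i, (ascPochhammer ℂ n).eval (1 + s - a i) * Gamma (a i - (s + n)) := by
        rw [gammaKernel, Finset.prod_mul_distrib, mul_left_comm]
    _ = _ := by
        simp only [hupper, hlower, Finset.prod_mul_distrib, Finset.prod_const, Finset.card_univ,
          gammaKernel]
        ring

end TerminatingSeries

section MeijerEnsembles

open Complex MeasureTheory Polynomial Set

variable {p q : ℕ} {a : Fin p → ℂ} {b : Fin q → ℂ} {c : ℝ} {n : ℕ}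

/-- The product `∏_j Γ(b_j + k + 1) ∏_i Γ(-a_i - k)`, the `k`-th moment of the Meijer function
`G^{q,p}_{p,q}` with upper parameters `a` and lower parameters `b` on `(0, ∞)`. -/
noncomputable def meijerMoment (a : Fin p → ℂ) (b : Fin q → ℂ) (k : ℕ) : ℂ :=
  gammaKernel (fun i => 1 - a i) b (k + 1)

/-- The functions spanning a Meijer ensemble: `G^{q,p}_{p,q}` with the `i₀`-th upper parameter
lowered by `j`, with contour `re u = c`. -/
noncomputable def meijerWeight (c : ℝ) (a : Fin p → ℂ) (b : Fin q → ℂ) (i₀ : Fin p) (j : ℕ)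
    (x : ℝ) : ℂ :=
  meijerG c q p (Function.update a i₀ (a i₀ - j)) b x

/-- The functions of a Meijer ensemble dual to its orthogonal polynomials, with contour
`re u = c`. The factor in front makes the `l`-th one pair to `1` with `x ^ l`. -/
noncomputable def meijerDual (c : ℝ) (a : Fin p → ℂ) (b : Fin q → ℂ) (l : ℕ) (x : ℝ) : ℂ :=
  ((l.factorial : ℂ) * meijerMoment a b l)⁻¹ *
    meijerG c (q + 1) p (Fin.snoc a (-(l : ℂ)) : Fin (p + 1) → ℂ)
      (Fin.cons 0 b : Fin (q + 1) → ℂ) x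

/-- The orthogonal polynomials of a Meijer ensemble in hypergeometric form. They are monic where
the moments up to the `n`-th are nonzero. -/
noncomputable def meijerPoly (a : Fin p → ℂ) (b : Fin q → ℂ) (n : ℕ) (x : ℝ) : ℂ :=
  (-1) ^ n * (meijerMoment a b n / meijerMoment a b 0) *
    hypergeomPFQ (Fin.cons (-(n : ℂ)) (fun i => 1 + a i) : Fin (p + 1) → ℂ) (fun j => 1 + b j)
      ((-1) ^ p * x)

theorem natCast_add_one_mem_gammaStrip {N k : ℕ} (ha : ∀ i, (a i).re < 1 - N)
    (hb : ∀ j, -1 < (b j).re) (hk : k < N) : (k + 1 : ℝ) ∈ gammaStrip (fun i => 1 - a i) b := by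
  have hkN : (k : ℝ) + 1 ≤ N := by exact_mod_cast hk
  refine ⟨fun j => ?_, fun i => ?_⟩
  · linarith [hb j, (k.cast_nonneg : (0 : ℝ) ≤ k)]
  · rw [sub_re, one_re]
    linarith [ha i]

theorem meijerMoment_ne_zero (hn : (n + 1 : ℝ) ∈ gammaStrip (fun i => 1 - a i) b) :
    meijerMoment a b n ≠ 0 :=
  gammaKernel_ne_zero (by simpa using hn)

theorem prod_ascPochhammer_div_eq_meijerMoment_div (h₀ : 1 ∈ gammaStrip (fun i => 1 - a i) b)
    (hn : (n + 1 : ℝ) ∈ gammaStrip (fun i => 1 - a i) b) :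
    (∏ i, (ascPochhammer ℂ n).eval (1 + a i)) / ∏ j, (ascPochhammer ℂ n).eval (1 + b j) =
      ((-1) ^ n) ^ p * (meijerMoment a b 0 / meijerMoment a b n) := by
  have hn' := meijerMoment_ne_zero hn
  have hasc : ∏ j, (ascPochhammer ℂ n).eval (1 + b j) ≠ 0 := by
    refine Finset.prod_ne_zero_iff.2 fun j _ => ?_
    have hb : 0 < (1 + b j).re := by simpa [add_comm] using h₀.1 j
    refine left_ne_zero_of_mul (b := Gamma (1 + b j)) ?_
    rw [← Gamma_add_natCast (Gamma_ne_zero_of_re_pos hb)]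
    refine Gamma_ne_zero_of_re_pos ?_
    rw [add_re, natCast_re]
    positivity
  have hshift := prod_ascPochhammer_mul_gammaKernel_add_natCast (a := fun i => 1 - a i) (b := b)
    (s := 1) (n := n) (by simpa using h₀) (by simpa [add_comm] using hn)
  simp only [add_comm _ (1 : ℂ), add_sub_sub_cancel, Fintype.card_fin] at hshift
  rw [meijerMoment, add_comm] at hn'
  rw [meijerMoment, meijerMoment, Nat.cast_zero, zero_add, add_comm (n : ℂ) 1, ← mul_div_assoc,
    div_eq_div_iff hasc hn', hshift]
  ring

theorem meijerPoly_eq_eval_momentPolynomial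
    (h : ∀ k ≤ n, (k + 1 : ℝ) ∈ gammaStrip (fun i => 1 - a i) b) (x : ℝ) :
    meijerPoly a b n x = (momentPolynomial (meijerMoment a b) n).eval (x : ℂ) := by
  have h₀ : 1 ∈ gammaStrip (fun i => 1 - a i) b := by simpa using h 0 n.zero_le
  have hm₀ : meijerMoment a b 0 ≠ 0 := meijerMoment_ne_zero (h 0 n.zero_le)
  rw [meijerPoly, hypergeomPFQ_cons_neg_natCast, Finset.mul_sum, eval_eq_sum_range'
    (Nat.lt_succ_iff.2 (natDegree_momentPolynomial_le _ n))]
  refine Finset.sum_congr rfl fun k hk => ?_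
  have hkn := h k (Nat.lt_succ_iff.1 (Finset.mem_range.1 hk))
  have hmk := meijerMoment_ne_zero hkn
  have hsign : ((-1 : ℂ) ^ k) ^ p * ((-1) ^ p) ^ k = 1 := by
    rw [← pow_mul, ← pow_mul', mul_comm k, ← mul_pow, neg_one_mul, neg_neg, one_pow]
  rw [prod_ascPochhammer_div_eq_meijerMoment_div h₀ hkn, coeff_momentPolynomial, mul_pow, pow_add]
  field_simp
  linear_combination meijerMoment a b n * n.choose k * (x : ℂ) ^ k * hsign

theorem SeparatesPoles.verticalIntegrable [Nonempty (Fin p)] (h : SeparatesPoles c q p a b) :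
    VerticalIntegrable (meijerKernel q p a b) c := by
  rw [← verticalIntegrable_comp_neg_iff]
  simpa only [meijerKernel_neg] using
    (stripDecay_gammaKernel _ _).verticalIntegrable (separatesPoles_iff.1 h)

theorem SeparatesPoles.integrableOn_pow_mul_meijerG [Nonempty (Fin p)]
    (h : SeparatesPoles c q p a b) (hn : (n + 1 : ℝ) ∈ gammaStrip (fun i => 1 - a i) b) :
    IntegrableOn (fun x : ℝ => (x : ℂ) ^ n * meijerG c q p a b x) (Ioi 0) := by
  have hconv := (stripDecay_gammaKernel _ _).mellinConvergent isOpen_gammaStrip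
    (separatesPoles_iff.1 h) (s := (n : ℂ) + 1) (by simpa using hn)
  simpa only [mellinConvergent_natCast_add_one_iff, meijerG_eq_mellinInv, meijerKernel_neg,
    smul_eq_mul] using hconv

theorem one_sub_update_sub_natCast (a : Fin p → ℂ) (i₀ : Fin p) (j : ℕ) :
    (fun i => 1 - Function.update a i₀ (a i₀ - j) i) =
      Function.update (fun i => 1 - a i) i₀ (1 - a i₀ + j) := by
  ext i
  rcases eq_or_ne i i₀ with rfl | hi
  · simp [sub_add]
  · simp [hi]

theorem meijerWeight_eq_mellinInv (c : ℝ) (a : Fin p → ℂ) (b : Fin q → ℂ) (i₀ : Fin p) (j : ℕ)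
    (x : ℝ) :
    meijerWeight c a b i₀ j x =
      mellinInv (-c) (gammaKernel (Function.update (fun i => 1 - a i) i₀ (1 - a i₀ + j)) b) x := by
  simp only [meijerWeight, meijerG_eq_mellinInv, meijerKernel_neg, one_sub_update_sub_natCast]

theorem integrableOn_pow_mul_meijerWeight {i₀ : Fin p} {j : ℕ}
    (h : SeparatesPoles c q p (Function.update a i₀ (a i₀ - j)) b)
    (hn : (n + 1 : ℝ) ∈ gammaStrip (fun i => 1 - a i) b) :
    IntegrableOn (fun x : ℝ => (x : ℂ) ^ n * meijerWeight c a b i₀ j x) (Ioi 0) := by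
  have : Nonempty (Fin p) := ⟨i₀⟩
  refine h.integrableOn_pow_mul_meijerG ?_
  rw [one_sub_update_sub_natCast]
  exact gammaStrip_subset_update i₀ j hn

section Dual

variable {l : ℕ} (h : SeparatesPoles c (q + 1) p (Fin.snoc a (-(l : ℂ)) : Fin (p + 1) → ℂ)
  (Fin.cons 0 b : Fin (q + 1) → ℂ))

include h

theorem eqOn_meijerKernel_snoc_cons_zero :
    EqOn (fun s => meijerKernel (q + 1) p (Fin.snoc a (-(l : ℂ)) : Fin (p + 1) → ℂ)
        (Fin.cons 0 b : Fin (q + 1) → ℂ) (-s))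
      (fun s => ((descPochhammer ℂ l).comp (X - 1)).eval s * gammaKernel (fun i => 1 - a i) b s)
      (re ⁻¹' {-c}) := fun s hs => by
  refine meijerKernel_snoc_cons_zero_neg a b l ?_
  rw [mem_preimage, mem_singleton_iff] at hs
  simpa [hs] using (separatesPoles_snoc_cons_iff.1 h).1

theorem verticalIntegrable_meijerKernel_snoc_cons_zero [Nonempty (Fin p)] :
    VerticalIntegrable (meijerKernel (q + 1) p (Fin.snoc a (-(l : ℂ)) : Fin (p + 1) → ℂ)
      (Fin.cons 0 b : Fin (q + 1) → ℂ)) c := by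
  rw [← verticalIntegrable_comp_neg_iff]
  refine ((stripDecay_eval_mul_gammaKernel _ b
    ((descPochhammer ℂ l).comp (X - 1))).verticalIntegrable
    (separatesPoles_snoc_cons_iff.1 h).2).congr (ae_of_all _ fun t => ?_)
  exact (eqOn_meijerKernel_snoc_cons_zero h (by simp)).symm

theorem meijerDual_eq_mellinInv (x : ℝ) :
    meijerDual c a b l x = ((l.factorial : ℂ) * meijerMoment a b l)⁻¹ * mellinInv (-c)
      (fun s => ((descPochhammer ℂ l).comp (X - 1)).eval s * gammaKernel (fun i => 1 - a i) b s)
      x := by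
  rw [meijerDual, meijerG_eq_mellinInv, mellinInv_congr (eqOn_meijerKernel_snoc_cons_zero h)]

variable [Nonempty (Fin p)] (hn : (n + 1 : ℝ) ∈ gammaStrip (fun i => 1 - a i) b)

include hn

theorem integrableOn_pow_mul_meijerDual :
    IntegrableOn (fun x : ℝ => (x : ℂ) ^ n * meijerDual c a b l x) (Ioi 0) := by
  have hconv := (stripDecay_eval_mul_gammaKernel _ b
    ((descPochhammer ℂ l).comp (X - 1))).mellinConvergent isOpen_gammaStrip
    (separatesPoles_snoc_cons_iff.1 h).2 (s := (n : ℂ) + 1) (by simpa using hn)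
  rw [mellinConvergent_natCast_add_one_iff] at hconv
  simp only [meijerDual_eq_mellinInv h, mul_left_comm _ (_⁻¹)]
  exact hconv.const_mul _

theorem integral_pow_mul_meijerDual :
    ∫ x in Ioi (0 : ℝ), (x : ℂ) ^ n * meijerDual c a b l x =
      n.choose l * (meijerMoment a b n / meijerMoment a b l) := by
  have hmellin := (stripDecay_eval_mul_gammaKernel _ b
    ((descPochhammer ℂ l).comp (X - 1))).mellin_mellinInv isOpen_gammaStrip
    (separatesPoles_snoc_cons_iff.1 h).2 (s := (n : ℂ) + 1) (by simpa using hn)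
  simp only [mellin_natCast_add_one, eval_comp, eval_sub, eval_X, eval_one, add_sub_cancel_right,
    descPochhammer_eval_eq_descFactorial, smul_eq_mul] at hmellin
  simp only [meijerDual_eq_mellinInv h, mul_left_comm _ (_⁻¹), eval_comp, eval_sub, eval_X,
    eval_one]
  rw [integral_const_mul, hmellin, Nat.descFactorial_eq_factorial_mul_choose, ← meijerMoment]
  have hfac : (l.factorial : ℂ) ≠ 0 := Nat.cast_ne_zero.2 l.factorial_ne_zero
  rw [Nat.cast_mul]
  field_simp

end Dual

variable {N : ℕ} {i₀ : Fin p} {cI cQ : Fin N → ℝ}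

theorem exists_meijerDual_eq_sum {c : ℝ} {l : Fin N}
    (hI : ∀ j : Fin N, SeparatesPoles (cI j) q p (Function.update a i₀ (a i₀ - (j : ℕ))) b)
    (h : SeparatesPoles c (q + 1) p (Fin.snoc a (-((l : ℕ) : ℂ)) : Fin (p + 1) → ℂ)
      (Fin.cons 0 b : Fin (q + 1) → ℂ)) :
    ∃ d : Fin N → ℂ, ∀ x : ℝ, 0 < x →
      meijerDual c a b l x = ∑ j ∈ Finset.Iic l, d j * meijerWeight (cI j) a b i₀ j x := by
  obtain ⟨d, hd⟩ := exists_mellinInv_eval_mul_gammaKernel_eq_sum (fun i => 1 - a i) b i₀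
    ((descPochhammer ℂ l).comp (X - 1))
  have hdeg : ((descPochhammer ℂ l).comp (X - 1)).natDegree = l := by
    rw [natDegree_comp, ← C_1, natDegree_X_sub_C, mul_one, descPochhammer_natDegree]
  have hc := (separatesPoles_snoc_cons_iff.1 h).2
  have : Nonempty (Fin p) := ⟨i₀⟩
  have hweight : ∀ j : Fin N, ∀ x : ℝ, 0 < x →
      mellinInv (-c) (gammaKernel (Function.update (fun i => 1 - a i) i₀ (1 - a i₀ + (j : ℕ))) b) x
        = meijerWeight (cI j) a b i₀ j x := fun j x hx => by
    rw [meijerWeight_eq_mellinInv]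
    have hIj := separatesPoles_iff.1 (hI j)
    rw [one_sub_update_sub_natCast] at hIj
    exact (stripDecay_gammaKernel _ b).mellinInv_eq (gammaStrip_subset_update i₀ j hc) hIj hx
  refine ⟨fun j => (((l : ℕ).factorial : ℂ) * meijerMoment a b l)⁻¹ * d j, fun x hx => ?_⟩
  rw [meijerDual_eq_mellinInv h, hd _ hc x hx, hdeg, ← Fin.map_valEmbedding_Iic, Finset.sum_map,
    Finset.mul_sum]
  exact Finset.sum_congr rfl fun j _ => by rw [Fin.valEmbedding_apply, hweight j x hx, mul_assoc]

section Pairing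

variable {n l : ℕ} {c : ℝ} [Nonempty (Fin p)]
  (hn : ∀ k ≤ n, (k + 1 : ℝ) ∈ gammaStrip (fun i => 1 - a i) b)
  (h : SeparatesPoles c (q + 1) p (Fin.snoc a (-(l : ℂ)) : Fin (p + 1) → ℂ)
    (Fin.cons 0 b : Fin (q + 1) → ℂ))

include hn h

theorem integrableOn_meijerPoly_mul_meijerDual :
    IntegrableOn (fun x => meijerPoly a b n x * meijerDual c a b l x) (Ioi 0) := by
  simp only [meijerPoly_eq_eval_momentPolynomial hn]
  exact integrable_eval_ofReal_mul (natDegree_momentPolynomial_le _ n) fun k hk =>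
    integrableOn_pow_mul_meijerDual h (hn k hk)

theorem integral_meijerPoly_mul_meijerDual :
    ∫ x in Ioi (0 : ℝ), meijerPoly a b n x * meijerDual c a b l x = if n = l then 1 else 0 := by
  simp only [meijerPoly_eq_eval_momentPolynomial hn]
  rw [integral_eval_ofReal_mul (natDegree_momentPolynomial_le _ n) fun k hk =>
      integrableOn_pow_mul_meijerDual h (hn k hk),
    ← sum_coeff_momentPolynomial_mul_choose (fun k hk => meijerMoment_ne_zero (hn k hk)) l]
  refine Finset.sum_congr rfl fun k hk => ?_
  rw [integral_pow_mul_meijerDual h (hn k (Nat.lt_succ_iff.1 (Finset.mem_range.1 hk)))]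

end Pairing

theorem isBiorthogonalSystem_meijer (ha : ∀ i, (a i).re < 1 - N) (hb : ∀ j, -1 < (b j).re)
    (hI : ∀ j : Fin N, SeparatesPoles (cI j) q p (Function.update a i₀ (a i₀ - (j : ℕ))) b)
    (hQ : ∀ l : Fin N, SeparatesPoles (cQ l) (q + 1) p
      (Fin.snoc a (-((l : ℕ) : ℂ)) : Fin (p + 1) → ℂ) (Fin.cons 0 b : Fin (q + 1) → ℂ)) :
    IsBiorthogonalSystem (fun j : Fin N => meijerWeight (cI j) a b i₀ j)
      (fun n => meijerPoly a b n) (fun l => meijerDual (cQ l) a b l) := by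
  have : Nonempty (Fin p) := ⟨i₀⟩
  have hstrip : ∀ n : Fin N, ∀ k ≤ (n : ℕ), (k + 1 : ℝ) ∈ gammaStrip (fun i => 1 - a i) b :=
    fun n k hk => natCast_add_one_mem_gammaStrip ha hb (hk.trans_lt n.isLt)
  have hne : ∀ n : Fin N, meijerMoment a b n ≠ 0 := fun n =>
    meijerMoment_ne_zero (hstrip n n le_rfl)
  exact
    { monic := fun n => ⟨momentPolynomial (meijerMoment a b) n, monic_momentPolynomial (hne n),
        natDegree_momentPolynomial (hne n), meijerPoly_eq_eval_momentPolynomial (hstrip n)⟩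
      span := fun l => exists_meijerDual_eq_sum hI (hQ l)
      integrable := fun n l => integrableOn_meijerPoly_mul_meijerDual (hstrip n) (hQ l)
      biorthogonal := fun n l => by
        rw [integral_meijerPoly_mul_meijerDual (hstrip n) (hQ l)]
        simp only [Fin.ext_iff] }

end MeijerEnsembles

section GinibreProducts

open Complex

variable {r s N : ℕ} {μ : Fin s → ℕ} {ν : Fin r → ℕ}

theorem weightUpper_eq_update (N : ℕ) (μ : Fin s → ℕ) (i₀ : Fin s) (hi₀ : i₀.val = 0) (j : ℕ) :
    weightUpper N μ j = Function.update (fun i => -((μ i : ℂ) + N)) i₀ (-((μ i₀ : ℂ) + N) - j) := by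
  ext i
  rcases eq_or_ne i i₀ with rfl | hi
  · rw [weightUpper, if_pos hi₀, Function.update_self]
    ring
  · rw [weightUpper, if_neg (hi₀ ▸ Fin.val_ne_of_ne hi), Function.update_of_ne hi]

theorem dualLower_eq_cons (ν : Fin r → ℕ) :
    dualLower ν = Fin.cons (α := fun _ => ℂ) 0 (weightLower ν) := by
  ext j
  refine Fin.cases ?_ (fun j => ?_) j <;> simp [dualLower, extendedNu, weightLower]

theorem meijerMoment_eq_prod_Gamma (N : ℕ) (μ : Fin s → ℕ) (ν : Fin r → ℕ) (k : ℕ) :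
    meijerMoment (fun i => -((μ i : ℂ) + N)) (weightLower ν) k =
      (∏ j, Gamma ((ν j : ℂ) + k + 1)) * ∏ i, Gamma ((μ i : ℂ) + N - k) := by
  simp only [meijerMoment, gammaKernel, weightLower]
  congr 1 <;> refine Finset.prod_congr rfl fun i _ => congrArg Gamma ?_ <;> ring

theorem weightFun_eq_meijerWeight (i₀ : Fin s) (hi₀ : i₀.val = 0) (c : ℝ) (j : ℕ) :
    weightFun N μ ν c j = meijerWeight c (fun i => -((μ i : ℂ) + N)) (weightLower ν) i₀ j := by
  ext x
  rw [weightFun, meijerWeight, weightUpper_eq_update N μ i₀ hi₀]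

theorem constC_eq (l : ℕ) :
    constC N μ ν l =
      (-1) ^ l * (l.factorial * meijerMoment (fun i => -((μ i : ℂ) + N)) (weightLower ν) l) := by
  simp only [constC, Fin.prod_univ_succ, extendedNu, Fin.cons_zero, Fin.cons_succ, Nat.cast_zero,
    zero_add, Gamma_nat_eq_factorial, meijerMoment_eq_prod_Gamma, mul_assoc]

theorem dualFun_eq_meijerDual (c : ℝ) (l : ℕ) :
    dualFun N μ ν c l = meijerDual c (fun i => -((μ i : ℂ) + N)) (weightLower ν) l := by
  ext x
  rw [dualFun, meijerDual, dualLower_eq_cons, constC_eq, div_mul_cancel_left₀ (by simp)]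
  rfl

theorem polyFun_eq_meijerPoly (n : ℕ) :
    polyFun N μ ν n = meijerPoly (fun i => -((μ i : ℂ) + N)) (weightLower ν) n := by
  ext x
  have hupper : (fun i => 1 - (μ i : ℂ) - N) = fun i => 1 + -((μ i : ℂ) + N) := by
    ext i
    ring
  rw [polyFun, meijerPoly, meijerMoment_eq_prod_Gamma, meijerMoment_eq_prod_Gamma, hupper,
    Finset.prod_div_distrib, Finset.prod_div_distrib, mul_div_mul_comm]
  simp only [Nat.cast_zero, add_zero, sub_zero, mul_assoc]
  rfl

theorem neg_natCast_add_natCast_re_lt (N : ℕ) (μ : Fin s → ℕ) (i : Fin s) :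
    (-((μ i : ℂ) + N)).re < 1 - N := by
  rw [neg_re, add_re, natCast_re, natCast_re]
  linarith [(μ i).cast_nonneg (α := ℝ)]

theorem neg_one_lt_weightLower_re (ν : Fin r → ℕ) (j : Fin r) : -1 < (weightLower ν j).re := by
  rw [weightLower, natCast_re]
  exact neg_one_lt_zero.trans_le (Nat.cast_nonneg _)

end GinibreProducts

theorem proposition4_general {p q N : ℕ} {a : Fin p → ℂ} {b : Fin q → ℂ}
    (ha : ∀ i, (a i).re < 1 - N) (hb : ∀ j, -1 < (b j).re) (i₀ : Fin p) {cI cQ : Fin N → ℝ}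
    (hI : ∀ j : Fin N, SeparatesPoles (cI j) q p (Function.update a i₀ (a i₀ - (j : ℕ))) b)
    (hQ : ∀ l : Fin N, SeparatesPoles (cQ l) (q + 1) p
      (Fin.snoc a (-((l : ℕ) : ℂ)) : Fin (p + 1) → ℂ) (Fin.cons 0 b : Fin (q + 1) → ℂ)) :
    let φ : Fin N → ℝ → ℂ := fun j => meijerWeight (cI j) a b i₀ j
    let P : Fin N → ℝ → ℂ := fun n => meijerPoly a b n
    let Q : Fin N → ℝ → ℂ := fun l => meijerDual (cQ l) a b l
    (∀ j : Fin N, Complex.VerticalIntegrable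
      (meijerKernel q p (Function.update a i₀ (a i₀ - (j : ℕ))) b) (cI j)) ∧
    (∀ l : Fin N, Complex.VerticalIntegrable
      (meijerKernel (q + 1) p (Fin.snoc a (-((l : ℕ) : ℂ)) : Fin (p + 1) → ℂ)
        (Fin.cons 0 b : Fin (q + 1) → ℂ)) (cQ l)) ∧
    IsBiorthogonalSystem φ P Q ∧
    (∀ P' Q' : Fin N → ℝ → ℂ, IsBiorthogonalSystem φ P' Q' →
      ∀ n : Fin N, (∀ x : ℝ, P' n x = P n x) ∧ (∀ x : ℝ, 0 < x → Q' n x = Q n x)) ∧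
    MeasureTheory.IntegrableOn (ensembleWeight φ) (posOrthant N) ∧
    (∫ x in posOrthant N, ensembleWeight φ x) ≠ 0 ∧
    (∀ k : ℕ, k ≤ N → ∀ x : Fin k → ℝ, (∀ i, 0 < x i) →
      correlationFunction (ensembleWeight φ) k x =
        (Matrix.of fun i j : Fin k => biorthogonalKernel P Q (x i) (x j)).det) := by
  intro φ P Q
  have : Nonempty (Fin p) := ⟨i₀⟩
  have hsys : IsBiorthogonalSystem φ P Q := isBiorthogonalSystem_meijer ha hb hI hQ
  have hφ : ∀ k j : Fin N, MeasureTheory.IntegrableOn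
      (fun x : ℝ => (x : ℂ) ^ (k : ℕ) * φ j x) (Set.Ioi 0) := fun k j =>
    integrableOn_pow_mul_meijerWeight (hI j) (natCast_add_one_mem_gammaStrip ha hb k.isLt)
  exact ⟨fun j => (hI j).verticalIntegrable,
    fun l => verticalIntegrable_meijerKernel_snoc_cons_zero (hQ l), hsys,
    fun _ _ h' => hsys.unique hφ h', hsys.integrableOn_ensembleWeight hφ,
    hsys.integral_ensembleWeight_ne_zero hφ,
    fun _ hk _ hx => hsys.correlationFunction_ensembleWeight hφ hk hx⟩

theorem proposition4 (r s N : ℕ) (hs : 1 ≤ s) (μ : Fin s → ℕ) (ν : Fin r → ℕ)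
    (cI cQ : Fin N → ℝ)
    (hcI : ∀ j : Fin N, SeparatesPoles (cI j) r s (weightUpper N μ j) (weightLower ν))
    (hcQ : ∀ l : Fin N, SeparatesPoles (cQ l) (r + 1) s (dualUpper N μ l) (dualLower ν)) :
    let φ : Fin N → ℝ → ℂ := fun j => weightFun N μ ν (cI j) j
    let P : Fin N → ℝ → ℂ := fun n => polyFun N μ ν n
    let Q : Fin N → ℝ → ℂ := fun l => dualFun N μ ν (cQ l) l
    -- the contour integrals converge absolutely
    (∀ j : Fin N, Complex.VerticalIntegrable
      (meijerKernel r s (weightUpper N μ j) (weightLower ν)) (cI j)) ∧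
    (∀ l : Fin N, Complex.VerticalIntegrable
      (meijerKernel (r + 1) s (dualUpper N μ l) (dualLower ν)) (cQ l)) ∧
    -- `P`, `Q` is the biorthogonal system of the ensemble
    IsBiorthogonalSystem φ P Q ∧
    (∀ P' Q' : Fin N → ℝ → ℂ, IsBiorthogonalSystem φ P' Q' →
      ∀ n : Fin N, (∀ x : ℝ, P' n x = P n x) ∧ (∀ x : ℝ, 0 < x → Q' n x = Q n x)) ∧
    -- the weight can be normalized, and `K_N` is the correlation kernel of the ensemble
    MeasureTheory.IntegrableOn (ensembleWeight φ) (posOrthant N) ∧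
    (∫ x in posOrthant N, ensembleWeight φ x) ≠ 0 ∧
    (∀ k : ℕ, k ≤ N → ∀ x : Fin k → ℝ, (∀ i, 0 < x i) →
      correlationFunction (ensembleWeight φ) k x =
        (Matrix.of fun i j : Fin k => biorthogonalKernel P Q (x i) (x j)).det) := by
  simp only [weightFun_eq_meijerWeight ⟨0, hs⟩ rfl, polyFun_eq_meijerPoly, dualFun_eq_meijerDual,
    weightUpper_eq_update N μ ⟨0, hs⟩ rfl, dualLower_eq_cons, dualUpper] at hcI hcQ ⊢
  exact proposition4_general (neg_natCast_add_natCast_re_lt N μ) (neg_one_lt_weightLower_re ν)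
    ⟨0, hs⟩ hcI hcQ
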